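/- Let $\mathrm{Oper}$ be the category of small symmetric coloured operads (also called symmetric multicategories) and morphisms of operads. An operad is called rigid if each of its invertible unary operations is the identity of a colour; let $\mathrm{rOper}$ be the full subcategory of $\mathrm{Oper}$ whose objects are the rigid operads. For a category $\mathcal{C}$, let $\mathrm{Aut}(\mathcal{C})$ be the full subcategory of the category of functors $\mathcal{C}\to\mathcal{C}$ and natural transformations whose objects are the equivalences of categories. Then $\mathrm{Aut}(\mathrm{Oper})$ and $\mathrm{Aut}(\mathrm{rOper})$ are contractible groupoids, i.e., each of them is a non-empty groupoid with exactly one morphism between any two objects. -/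

import Mathlib

open CategoryTheory

universe u

/-- The position `k` in a concatenation of tuples of lengths `m 0, m 1, …`, written as the pair
of the index of the tuple and the position in that tuple (lexicographic order). -/
def splitIdx {n : ℕ} {m : Fin n → ℕ} : Fin (∑ i, m i) ≃ (i : Fin n) × Fin (m i) :=
  finSigmaFinEquiv.symm

/-- The concatenation of the tuples `b 0, b 1, …`. -/
abbrev concatTuple {C : Type u} {n : ℕ} {m : Fin n → ℕ} (b : ∀ i, Fin (m i) → C) :
    Fin (∑ i, m i) → C :=
  fun k => b (splitIdx k).1 (splitIdx k).2

theorem concatTuple_symm {C : Type u} {n : ℕ} {m : Fin n → ℕ} (b : ∀ i, Fin (m i) → C)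
    (s : (i : Fin n) × Fin (m i)) : concatTuple b (splitIdx.symm s) = b s.1 s.2 := by
  rw [concatTuple, Equiv.apply_symm_apply]

/-- The identification of the positions of a two-step concatenation, bracketed in the two
possible ways. -/
def assocIdx {n : ℕ} {m : Fin n → ℕ} (l : ∀ i, Fin (m i) → ℕ) :
    Fin (∑ k : Fin (∑ i, m i), l (splitIdx k).1 (splitIdx k).2) ≃ Fin (∑ i, ∑ j, l i j) :=
  splitIdx.trans <|
    (Equiv.sigmaCongrLeft (β := fun s : (i : Fin n) × Fin (m i) => Fin (l s.1 s.2))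
      splitIdx).trans <|
    (Equiv.sigmaAssoc fun i j => Fin (l i j)).trans <|
    (Equiv.sigmaCongrRight fun _ => splitIdx.symm).trans splitIdx.symm

/-- A concatenation of `n` tuples of length one is an `n`-tuple. -/
def onesIdx (n : ℕ) : Fin (∑ _ : Fin n, 1) ≃ Fin n :=
  splitIdx.trans (Equiv.sigmaUnique (Fin n) fun _ => Fin 1)

/-- A concatenation of a single `n`-tuple is an `n`-tuple. -/
def singleIdx (n : ℕ) : Fin (∑ _ : Fin 1, n) ≃ Fin n :=
  splitIdx.trans ((Equiv.sigmaEquivProd (Fin 1) (Fin n)).trans (Equiv.uniqueProd (Fin n) (Fin 1)))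

/-- The block permutation that permutes whole tuples according to `σ`. -/
def blockIdx {n : ℕ} (m : Fin n → ℕ) (σ : Equiv.Perm (Fin n)) :
    Fin (∑ i, m (σ i)) ≃ Fin (∑ i, m i) :=
  splitIdx.trans ((Equiv.sigmaCongrLeft (β := fun i => Fin (m i)) σ).trans splitIdx.symm)

/-- The direct sum of the permutations `τ i`, which acts inside each tuple. -/
def sumIdx {n : ℕ} {m : Fin n → ℕ} (τ : ∀ i, Equiv.Perm (Fin (m i))) :
    Fin (∑ i, m i) ≃ Fin (∑ i, m i) :=
  splitIdx.trans ((Equiv.sigmaCongrRight τ).trans splitIdx.symm)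

theorem concatTuple_assocIdx {C : Type u} {n : ℕ} {m : Fin n → ℕ} {l : ∀ i, Fin (m i) → ℕ}
    (a : ∀ i j, Fin (l i j) → C) :
    concatTuple (fun k : Fin (∑ i, m i) => a (splitIdx k).1 (splitIdx k).2) =
      concatTuple (fun i => concatTuple (a i)) ∘ assocIdx l := by
  funext k
  exact ((concatTuple_symm (fun i => concatTuple (a i)) ⟨(splitIdx (splitIdx k).1).1,
    splitIdx.symm ⟨(splitIdx (splitIdx k).1).2, (splitIdx k).2⟩⟩).trans
    (concatTuple_symm (a _) ⟨(splitIdx (splitIdx k).1).2, (splitIdx k).2⟩)).symm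

theorem concatTuple_blockIdx {C : Type u} {n : ℕ} {m : Fin n → ℕ} (b : ∀ i, Fin (m i) → C)
    (σ : Equiv.Perm (Fin n)) :
    concatTuple (fun i => b (σ i)) = concatTuple b ∘ blockIdx m σ := by
  funext k
  exact (concatTuple_symm b ⟨σ (splitIdx k).1, (splitIdx k).2⟩).symm

theorem concatTuple_sumIdx {C : Type u} {n : ℕ} {m : Fin n → ℕ} (b : ∀ i, Fin (m i) → C)
    (τ : ∀ i, Equiv.Perm (Fin (m i))) :
    concatTuple (fun i => b i ∘ τ i) = concatTuple b ∘ sumIdx τ := by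
  funext k
  exact (concatTuple_symm b ⟨(splitIdx k).1, τ _ (splitIdx k).2⟩).symm

/-- The data of a small symmetric coloured operad. -/
structure OperadData where
  /-- the set of colours -/
  Colour : Type u
  /-- the set `P(c₁, …, cₙ; d)` of operations -/
  Ops {n : ℕ} (c : Fin n → Colour) (d : Colour) : Type u
  /-- the action `p ↦ pσ` of the symmetric group,
  `P(c₁, …, cₙ; d) → P(c_{σ(1)}, …, c_{σ(n)}; d)` -/
  perm {n : ℕ} {c : Fin n → Colour} {d : Colour} (p : Ops c d) (σ : Equiv.Perm (Fin n)) :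
    Ops (c ∘ σ) d
  /-- the identity of a colour -/
  ident (c : Colour) : Ops (fun _ : Fin 1 => c) c
  /-- the composition `p ∘ (q₁, …, qₙ)` -/
  comp {n : ℕ} {c : Fin n → Colour} {d : Colour} (p : Ops c d)
    {m : Fin n → ℕ} {b : ∀ i, Fin (m i) → Colour} (q : ∀ i, Ops (b i) (c i)) :
    Ops (concatTuple b) d

namespace OperadData

variable (P : OperadData.{u})

/-- The action of the symmetric groups, written for a bijection between `Fin n'` and `Fin n`
whose source and target are equal only up to an equality `n' = n`. -/
def reindex {n' n : ℕ} {c' : Fin n' → P.Colour} {c : Fin n → P.Colour} {d : P.Colour}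
    (e : Fin n' ≃ Fin n) (h : c' = c ∘ e) (p : P.Ops c d) : P.Ops c' d := by
  obtain rfl : n' = n := Fin.equiv_iff_eq.mp ⟨e⟩
  subst h
  exact P.perm p e

/-- The set of unary operations from `a` to `b`. -/
abbrev Unary (a b : P.Colour) : Type u := P.Ops (fun _ : Fin 1 => a) b

/-- The composition `p ∘ q` of unary operations. -/
def unaryComp {a b c : P.Colour} (p : P.Unary b c) (q : P.Unary a b) : P.Unary a c :=
  P.reindex (onesIdx 1).symm rfl
    (P.comp p (m := fun _ => 1) (b := fun _ _ => a) fun _ => q)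

/-- The unary operation `p` is the identity of a colour. -/
inductive IsIdentity : ∀ {a b : P.Colour}, P.Unary a b → Prop
  | ident (c : P.Colour) : IsIdentity (P.ident c)

/-- The unary operation `p` is invertible. -/
def IsInvertible {a b : P.Colour} (p : P.Unary a b) : Prop :=
  ∃ q : P.Unary b a, P.unaryComp q p = P.ident a ∧ P.unaryComp p q = P.ident b

end OperadData

/-- A small symmetric coloured operad. -/
structure Operad extends OperadData.{u} where
  perm_one {n : ℕ} {c : Fin n → Colour} {d : Colour} (p : Ops c d) : perm p 1 = p
  perm_mul {n : ℕ} {c : Fin n → Colour} {d : Colour} (p : Ops c d)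
    (σ τ : Equiv.Perm (Fin n)) : perm p (σ * τ) = perm (perm p σ) τ
  comp_ident {n : ℕ} {c : Fin n → Colour} {d : Colour} (p : Ops c d) :
    comp p (m := fun _ => 1) (b := fun i _ => c i) (fun i => ident (c i)) =
      toOperadData.reindex (onesIdx n) rfl p
  ident_comp {n : ℕ} {c : Fin n → Colour} {d : Colour} (p : Ops c d) :
    comp (ident d) (m := fun _ => n) (b := fun _ => c) (fun _ => p) =
      toOperadData.reindex (singleIdx n) rfl p
  comp_assoc {n : ℕ} {c : Fin n → Colour} {d : Colour} (p : Ops c d)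
    {m : Fin n → ℕ} {b : ∀ i, Fin (m i) → Colour} (q : ∀ i, Ops (b i) (c i))
    {l : ∀ i, Fin (m i) → ℕ} {a : ∀ i j, Fin (l i j) → Colour} (r : ∀ i j, Ops (a i j) (b i j)) :
    comp (comp p q) (fun k => r (splitIdx k).1 (splitIdx k).2) =
      toOperadData.reindex (assocIdx l) (concatTuple_assocIdx a)
        (comp p fun i => comp (q i) (r i))
  perm_comp {n : ℕ} {c : Fin n → Colour} {d : Colour} (p : Ops c d)
    {m : Fin n → ℕ} {b : ∀ i, Fin (m i) → Colour} (q : ∀ i, Ops (b i) (c i))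
    (σ : Equiv.Perm (Fin n)) :
    comp (perm p σ) (fun i => q (σ i)) =
      toOperadData.reindex (blockIdx m σ) (concatTuple_blockIdx b σ) (comp p q)
  comp_perm {n : ℕ} {c : Fin n → Colour} {d : Colour} (p : Ops c d)
    {m : Fin n → ℕ} {b : ∀ i, Fin (m i) → Colour} (q : ∀ i, Ops (b i) (c i))
    (τ : ∀ i, Equiv.Perm (Fin (m i))) :
    comp p (fun i => perm (q i) (τ i)) =
      toOperadData.reindex (sumIdx τ) (concatTuple_sumIdx b τ) (comp p q)

namespace Operad

/-- A morphism of operads. -/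
@[ext]
structure Hom (P Q : Operad.{u}) where
  onColour : P.Colour → Q.Colour
  onOps {n : ℕ} {c : Fin n → P.Colour} {d : P.Colour} (p : P.Ops c d) :
    Q.Ops (onColour ∘ c) (onColour d)
  onOps_perm {n : ℕ} {c : Fin n → P.Colour} {d : P.Colour} (p : P.Ops c d)
    (σ : Equiv.Perm (Fin n)) : onOps (P.perm p σ) = Q.perm (onOps p) σ
  onOps_ident (c : P.Colour) : onOps (P.ident c) = Q.ident (onColour c)
  onOps_comp {n : ℕ} {c : Fin n → P.Colour} {d : P.Colour} (p : P.Ops c d)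
    {m : Fin n → ℕ} {b : ∀ i, Fin (m i) → P.Colour} (q : ∀ i, P.Ops (b i) (c i)) :
    onOps (P.comp p q) = Q.comp (onOps p) (b := fun i => onColour ∘ b i) (fun i => onOps (q i))

/-- The category of small symmetric coloured operads. -/
instance : Category.{u} Operad.{u} where
  Hom := Hom
  id P :=
    { onColour := fun c => c
      onOps := fun p => p
      onOps_perm := fun _ _ => rfl
      onOps_ident := fun _ => rfl
      onOps_comp := fun _ _ _ _ => rfl }
  comp f g :=
    { onColour := fun c => g.onColour (f.onColour c)
      onOps := fun p => g.onOps (f.onOps p)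
      onOps_perm := fun p σ => (congrArg g.onOps (f.onOps_perm p σ)).trans (g.onOps_perm _ σ)
      onOps_ident := fun c => (congrArg g.onOps (f.onOps_ident c)).trans (g.onOps_ident _)
      onOps_comp := fun p _ _ q => 
        (congrArg g.onOps (f.onOps_comp p q)).trans (g.onOps_comp (f.onOps p) fun i => f.onOps (q i)) }

/-- An operad is rigid if every invertible unary operation is the identity of a colour. -/
def IsRigid (P : Operad.{u}) : Prop :=
  ∀ ⦃a b : P.Colour⦄ (p : P.Unary a b), P.IsInvertible p → P.IsIdentity p

end Operad

/-- The category of rigid operads, a full subcategory of the category of operads. -/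
abbrev RigidOperad : Type (u + 1) :=
  ObjectProperty.FullSubcategory (fun P : Operad.{u} => P.IsRigid)

universe v w

/-- The category of autoequivalences of `C`: the full subcategory of the category of endofunctors
of `C` spanned by the equivalences of categories. -/
abbrev AutoequivCat (C : Type w) [Category.{v} C] :=
  ObjectProperty.FullSubcategory (fun F : C ⥤ C => F.IsEquivalence)

/-- A contractible groupoid: a non-empty groupoid with exactly one morphism between any two
objects, that is, a groupoid equivalent to the terminal category. -/
def IsContractibleGroupoid (C : Type w) [Category.{v} C] : Prop :=
  IsGroupoid C ∧ Nonempty C ∧ ∀ X Y : C, ∃! _f : X ⟶ Y, True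

/-!
Let `Φ` be a class of operads which contains the rigid operads and is closed under one construction,
`grafting`; both the class of all operads and that of rigid operads are of this kind. It is shown
that every autoequivalence `F` of the full subcategory on `Φ` is isomorphic to the identity functor
(`idIsoAutoequiv`), and that the identity functor has no endomorphism but the identity
(`id_endo_eq`). Both claims follow formally from these two facts
(`isContractibleGroupoid_autoequivCat`).

Colours of `P` are morphisms from the trivial operad to `P`, and `n`-ary operations are morphisms
from the corolla `Cₙ` with `n` inputs to `P` (`opHom`). Corollas are thin, so morphisms into them
are determined by their action on colours. An endomorphism of the identity functor is trivial on the
trivial operad, hence on all colours, hence on all corollas, hence on all operations.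

Given `F`, its value on the trivial operad is trivial (`nonempty_trivObj_iso`), so `F` induces
natural bijections on colours (`mapColour`). The images of the corollas are found as follows.

* For `n ≠ 1`, neither `F Cₙ` nor `F⁻¹ Cₙ` maps to the trivial operad, so both have non-unary
  operations. This gives morphisms `Cₖ ⟶ F Cₘ ⟶ Cₙ` with `k, m ≠ 1`, which forces `k = n`. As all
  endomorphisms of `Cₘ` and `Cₙ` are invertible, `F Cₘ ≅ Cₙ`, and counting colours gives `m = n`
  (`nonempty_corollaObj_iso_of_ne`).
* For `n = 1`, there are morphisms `C₁ ⟶ F C₁ ⟶ C₁` which are injective on colours: otherwise the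
  two colours of `F C₁` or `F⁻¹ C₁` could be swapped by an endomorphism. All endomorphisms of `C₁`
  that are injective on colours are invertible.

The isomorphism `Cₙ ≅ F Cₙ` can be chosen compatible with `mapColour` (`exists_corollaObj_iso`). It
suffices that it is so on the output colour. For `n = 0` this is the only colour, and for `n ≥ 2` it
is the only colour fixed by all endomorphisms. If it failed for `n = 1`, then `F` would reverse
unary operations while preserving nullary ones, and this is refuted by an operad with two colours
`⊥`, `⊤`, an operation from `⊥` to `⊤` and a nullary operation only for `⊤` (`implication`).

Consequently `F` induces natural bijections on operations (`mapOp`), compatible with identities and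
permutations since corollas are thin. For the composite of `p` and the `q i`, let `T = grafting p q`
be the operad whose colours are the edges of the tree with root vertex `p` and upper vertices `q i`,
and whose operations are those `r` in `P` for which evaluating the subtrees above the inputs of `r`
and then applying `r` gives, up to a permutation, the evaluation of the subtree above the output. A
condition on the heights of edges keeps `T` rigid if `P` is rigid (`isRigid_grafting`). The
associativity law makes this a suboperad of a pullback of `P`, and the composite is its only
operation from the leaves to the root. Therefore `mapOp` preserves this composite in `T` and, by
naturality, in `P` (`mapOp_comp`). The resulting morphism `P ⟶ F P` is a natural isomorphism.
-/

/-! ### Reindexing, pullbacks and suboperads -/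

namespace Operad

variable (P : Operad.{u})

theorem reindex_refl_eq {n : ℕ} {c : Fin n → P.Colour} {d : P.Colour} (e : Fin n ≃ Fin n)
    (he : e = Equiv.refl _) (h : c = c ∘ e) (p : P.Ops c d) : P.reindex e h p = p := by
  subst he
  exact P.perm_one p

theorem reindex_reindex {n n' n'' : ℕ} {c : Fin n → P.Colour} {c' : Fin n' → P.Colour}
    {c'' : Fin n'' → P.Colour} {d : P.Colour} (e : Fin n' ≃ Fin n) (h : c' = c ∘ e)
    (e' : Fin n'' ≃ Fin n') (h' : c'' = c' ∘ e') (p : P.Ops c d) :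
    P.reindex e' h' (P.reindex e h p) =
      P.reindex (e'.trans e) (h'.trans (congrArg (· ∘ e') h)) p := by
  obtain rfl : n' = n := Fin.equiv_iff_eq.mp ⟨e⟩
  obtain rfl : n'' = n' := Fin.equiv_iff_eq.mp ⟨e'⟩
  subst h; subst h'
  exact (P.perm_mul p e e').symm

theorem comp_reindex {n : ℕ} {c : Fin n → P.Colour} {d : P.Colour} (p : P.Ops c d)
    {m m' : Fin n → ℕ} {b : ∀ i, Fin (m i) → P.Colour} {b' : ∀ i, Fin (m' i) → P.Colour}
    (τ : ∀ i, Fin (m' i) ≃ Fin (m i)) (h : ∀ i, b' i = b i ∘ τ i)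
    (q : ∀ i, P.Ops (b i) (c i)) :
    ∃ (e : Fin (∑ i, m' i) ≃ Fin (∑ i, m i)) (h' : concatTuple b' = concatTuple b ∘ e),
      P.comp p (fun i => P.reindex (τ i) (h i) (q i)) = P.reindex e h' (P.comp p q) := by
  obtain rfl : m' = m := funext fun i => Fin.equiv_iff_eq.mp ⟨τ i⟩
  obtain rfl : b' = fun i => b i ∘ τ i := funext h
  exact ⟨_, _, P.comp_perm p q τ⟩

variable {P} in
theorem Hom.onOps_reindex {Q : Operad.{u}} (f : Hom P Q) {n n' : ℕ} {c : Fin n → P.Colour}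
    {c' : Fin n' → P.Colour} {d : P.Colour} (e : Fin n' ≃ Fin n) (h : c' = c ∘ e)
    (p : P.Ops c d) :
    f.onOps (P.reindex e h p) =
      Q.reindex e (congrArg (f.onColour ∘ ·) h) (f.onOps p) := by
  obtain rfl : n' = n := Fin.equiv_iff_eq.mp ⟨e⟩
  subst h
  exact f.onOps_perm p e

/-- The data of the operad `pullback f`. -/
def pullbackData {X : Type u} (f : X → P.Colour) : OperadData.{u} where
  Colour := X
  Ops c d := P.Ops (f ∘ c) (f d)
  perm p σ := P.perm p σ
  ident c := P.ident (f c)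
  comp p _ b q := P.comp p (b := fun i => f ∘ b i) q

theorem pullbackData_reindex {X : Type u} (f : X → P.Colour) {n n' : ℕ} {c : Fin n → X}
    {c' : Fin n' → X} {d : X} (e : Fin n' ≃ Fin n) (h : c' = c ∘ e) (p : P.Ops (f ∘ c) (f d)) :
    (P.pullbackData f).reindex (c := c) (c' := c') (d := d) e h p =
      P.reindex e (congrArg (f ∘ ·) h) p := by
  obtain rfl : n' = n := Fin.equiv_iff_eq.mp ⟨e⟩
  subst h
  rfl

/-- The operad with set of colours `X` whose operations are those of `P` between the images of
the colours under `f : X → P.Colour`. -/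
def pullback {X : Type u} (f : X → P.Colour) : Operad.{u} where
  toOperadData := P.pullbackData f
  perm_one p := P.perm_one p
  perm_mul p := P.perm_mul p
  comp_ident p := (P.comp_ident p).trans (P.pullbackData_reindex f _ _ p).symm
  ident_comp p := (P.ident_comp p).trans (P.pullbackData_reindex f _ _ p).symm
  comp_assoc p _ _ q _ _ r := (P.comp_assoc p q r).trans (P.pullbackData_reindex f _ _ _).symm
  perm_comp p _ _ q σ := (P.perm_comp p q σ).trans (P.pullbackData_reindex f _ _ _).symm
  comp_perm p _ _ q τ := (P.comp_perm p q τ).trans (P.pullbackData_reindex f _ _ _).symm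

/-- The projection of a pullback to the original operad. -/
def pullbackHom {X : Type u} (f : X → P.Colour) : P.pullback f ⟶ P :=
  ({ onColour := f
     onOps := fun p => p
     onOps_perm := fun _ _ => rfl
     onOps_ident := fun _ => rfl
     onOps_comp := fun _ _ _ _ => rfl } : Hom (P.pullback f) P)

/-- A set of operations of `P` which contains the identities and is closed under the symmetric
group actions and under composition. -/
structure OpsClosed (S : ∀ {n : ℕ} {c : Fin n → P.Colour} {d : P.Colour}, P.Ops c d → Prop) :
    Prop where
  perm {n : ℕ} {c : Fin n → P.Colour} {d : P.Colour} {p : P.Ops c d} (hp : S p)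
    (σ : Equiv.Perm (Fin n)) : S (P.perm p σ)
  ident (c : P.Colour) : S (P.ident c)
  comp {n : ℕ} {c : Fin n → P.Colour} {d : P.Colour} {p : P.Ops c d} (hp : S p)
    {m : Fin n → ℕ} {b : ∀ i, Fin (m i) → P.Colour} {q : ∀ i, P.Ops (b i) (c i)}
    (hq : ∀ i, S (q i)) : S (P.comp p q)

section WideSub

variable {P} {S : ∀ {n : ℕ} {c : Fin n → P.Colour} {d : P.Colour}, P.Ops c d → Prop}
  (hS : P.OpsClosed S)

/-- The data of the operad `wideSub hS`. -/
def wideSubData : OperadData.{u} where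
  Colour := P.Colour
  Ops c d := { p : P.Ops c d // S p }
  perm p σ := ⟨P.perm p.1 σ, hS.perm p.2 σ⟩
  ident c := ⟨P.ident c, hS.ident c⟩
  comp p _ _ q := ⟨P.comp p.1 fun i => (q i).1, hS.comp p.2 fun i => (q i).2⟩

theorem wideSubData_reindex {n n' : ℕ} {c : Fin n → P.Colour}
    {c' : Fin n' → P.Colour} {d : P.Colour} (e : Fin n' ≃ Fin n) (h : c' = c ∘ e)
    (p : { p : P.Ops c d // S p }) :
    ((wideSubData hS).reindex (c := c) (c' := c') (d := d) e h p).1 = P.reindex e h p.1 := by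
  obtain rfl : n' = n := Fin.equiv_iff_eq.mp ⟨e⟩
  subst h
  rfl

/-- The suboperad of `P` with all colours and the operations in `S`. -/
def wideSub : Operad.{u} where
  toOperadData := wideSubData hS
  perm_one p := Subtype.ext (P.perm_one p.1)
  perm_mul p σ τ := Subtype.ext (P.perm_mul p.1 σ τ)
  comp_ident p := Subtype.ext ((P.comp_ident p.1).trans (wideSubData_reindex hS _ _ p).symm)
  ident_comp p := Subtype.ext ((P.ident_comp p.1).trans (wideSubData_reindex hS _ _ p).symm)
  comp_assoc p _ _ q _ _ r := Subtype.ext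
    ((P.comp_assoc p.1 (fun i => (q i).1) fun i j => (r i j).1).trans
      (wideSubData_reindex hS _ _
        ((wideSubData hS).comp p fun i => (wideSubData hS).comp (q i) (r i))).symm)
  perm_comp p _ _ q σ := Subtype.ext
    ((P.perm_comp p.1 (fun i => (q i).1) σ).trans
      (wideSubData_reindex hS _ _ ((wideSubData hS).comp p q)).symm)
  comp_perm p _ _ q τ := Subtype.ext
    ((P.comp_perm p.1 (fun i => (q i).1) τ).trans
      (wideSubData_reindex hS _ _ ((wideSubData hS).comp p q)).symm)

/-- The inclusion of a wide suboperad. -/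
def wideSubHom : wideSub hS ⟶ P :=
  ({ onColour := fun c => c
     onOps := fun p => p.1
     onOps_perm := fun _ _ => rfl
     onOps_ident := fun _ => rfl
     onOps_comp := fun _ _ _ _ => rfl } : Hom (wideSub hS) P)

end WideSub

/-- The commutative operad, with one colour and one operation of each arity. -/
def comm : Operad.{u} where
  Colour := PUnit
  Ops _ _ := PUnit
  perm _ _ := ⟨⟩
  ident _ := ⟨⟩
  comp _ _ _ _ := ⟨⟩
  perm_one _ := rfl
  perm_mul _ _ _ := rfl
  comp_ident _ := rfl
  ident_comp _ := rfl
  comp_assoc _ _ _ _ _ _ _ := rfl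
  perm_comp _ _ _ _ _ := rfl
  comp_perm _ _ _ _ _ := rfl

/-- The operad with set of colours `X` which has exactly one operation of each type. -/
abbrev codiscrete (X : Type u) : Operad.{u} := comm.pullback fun _ : X => ⟨⟩

/-- An operad is thin if it has at most one operation of each type. -/
def IsThin : Prop :=
  ∀ {n : ℕ} (c : Fin n → P.Colour) (d : P.Colour), Subsingleton (P.Ops c d)

theorem isThin_wideSub_codiscrete {X : Type u}
    {S : ∀ {n : ℕ} {c : Fin n → X} {d : X}, (codiscrete X).Ops c d → Prop}
    (hS : (codiscrete X).OpsClosed S) : (wideSub hS).IsThin :=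
  fun _ _ => ⟨fun _ _ => Subtype.ext rfl⟩

variable {P}

theorem Hom.ext_of_isThin {Q : Operad.{u}} (hQ : Q.IsThin) {f g : P ⟶ Q}
    (h : f.onColour = g.onColour) : f = g := by
  obtain ⟨f, f', _, _, _⟩ := f
  obtain ⟨g, g', _, _, _⟩ := g
  obtain rfl : f = g := h
  refine Hom.ext rfl (heq_of_eq ?_)
  funext n c d p
  exact (hQ _ _).elim _ _

/-- In a thin operad, `IsRigid` only has to be tested on the existence of operations. -/
theorem isRigid_of_isThin (hP : P.IsThin)
    (h : ∀ a b : P.Colour, Nonempty (P.Unary a b) → Nonempty (P.Unary b a) → a = b) :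
    P.IsRigid := by
  rintro a b p ⟨q, -, -⟩
  obtain rfl := h a b ⟨p⟩ ⟨q⟩
  rw [(hP _ _).elim p (P.ident a)]
  exact .ident a

theorem Hom.onOps_unaryComp {Q : Operad.{u}} (f : P ⟶ Q) {a b c : P.Colour} (p : P.Unary b c)
    (q : P.Unary a b) :
    f.onOps (P.unaryComp p q) = Q.unaryComp (f.onOps p) (f.onOps q) := by
  refine (Hom.onOps_reindex f _ _ _).trans ?_
  rw [Hom.onOps_comp]
  rfl

theorem Hom.isInvertible {Q : Operad.{u}} (f : P ⟶ Q) {a b : P.Colour} {p : P.Unary a b}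
    (hp : P.IsInvertible p) : Q.IsInvertible (a := f.onColour a) (b := f.onColour b)
      (f.onOps p) := by
  obtain ⟨q, h1, h2⟩ := hp
  refine ⟨f.onOps q, ?_, ?_⟩
  · exact (Hom.onOps_unaryComp f q p).symm.trans ((congrArg f.onOps h1).trans (f.onOps_ident a))
  · exact (Hom.onOps_unaryComp f p q).symm.trans ((congrArg f.onOps h2).trans (f.onOps_ident b))

end Operad

/-! ### Permutations of an operation -/

namespace Operad

variable {P : Operad.{u}}

/-- The operation `r` arises from `p` by permuting the inputs. -/
def IsPermOf {n : ℕ} {c : Fin n → P.Colour} {d : P.Colour} (p : P.Ops c d) {k : ℕ}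
    {a : Fin k → P.Colour} {x : P.Colour} (r : P.Ops a x) : Prop :=
  ∃ (e : Fin k ≃ Fin n) (h : a = c ∘ e) (hd : d = x), r = hd ▸ P.reindex e h p

section IsPermOf

variable {n : ℕ} {c : Fin n → P.Colour} {d : P.Colour} {p : P.Ops c d} {k : ℕ}
    {a : Fin k → P.Colour} {x : P.Colour} {r : P.Ops a x}

theorem isPermOf_reindex (e : Fin k ≃ Fin n) (h : a = c ∘ e) (p : P.Ops c d) :
    IsPermOf p (P.reindex e h p) := ⟨e, h, rfl, rfl⟩

theorem IsPermOf.of_eq {e : Fin k ≃ Fin n} {h : a = c ∘ e} {p : P.Ops c d} {r : P.Ops a d}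
    (hr : r = P.reindex e h p) : IsPermOf p r := ⟨e, h, rfl, hr⟩

theorem IsPermOf.refl (p : P.Ops c d) : IsPermOf p p :=
  ⟨Equiv.refl _, rfl, rfl, (P.perm_one p).symm⟩

theorem IsPermOf.trans (h : IsPermOf p r) {l : ℕ} {b : Fin l → P.Colour} {y : P.Colour}
    {s : P.Ops b y} (h' : IsPermOf r s) : IsPermOf p s := by
  obtain ⟨e, h, rfl, rfl⟩ := h
  obtain ⟨e', h', rfl, rfl⟩ := h'
  exact ⟨e'.trans e, _, rfl, P.reindex_reindex e h e' h' p⟩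

theorem IsPermOf.symm (h : IsPermOf p r) : IsPermOf r p := by
  obtain ⟨e, h, rfl, rfl⟩ := h
  obtain rfl : k = n := Fin.equiv_iff_eq.mp ⟨e⟩
  subst h
  refine ⟨e.symm, by ext; simp, rfl, ?_⟩
  rw [P.reindex_reindex]
  exact (P.reindex_refl_eq _ (by simp) _ p).symm

theorem IsPermOf.perm (h : IsPermOf p r) (σ : Equiv.Perm (Fin k)) : IsPermOf p (P.perm r σ) :=
  h.trans (isPermOf_reindex σ rfl r)

theorem IsPermOf.comp (r : P.Ops a x) {m m' : Fin k → ℕ} {b : ∀ i, Fin (m i) → P.Colour}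
    {b' : ∀ i, Fin (m' i) → P.Colour} {q : ∀ i, P.Ops (b i) (a i)} {q' : ∀ i, P.Ops (b' i) (a i)}
    (h : ∀ i, IsPermOf (q i) (q' i)) : IsPermOf (P.comp r q) (P.comp r q') := by
  choose τ hτ _ hq using h
  obtain rfl : q' = fun i => P.reindex (τ i) (hτ i) (q i) := funext hq
  obtain ⟨e, h', he⟩ := P.comp_reindex r τ hτ q
  rw [he]
  exact isPermOf_reindex _ _ _

theorem IsPermOf.comp_ident (h : IsPermOf p r) {m : Fin k → ℕ}
    {b : ∀ i, Fin (m i) → P.Colour} {q : ∀ i, P.Ops (b i) (a i)}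
    (hq : ∀ i, IsPermOf (P.ident (a i)) (q i)) : IsPermOf p (P.comp r q) := by
  refine h.trans (IsPermOf.trans ?_ (IsPermOf.comp r hq))
  rw [P.comp_ident]
  exact isPermOf_reindex _ _ _

theorem IsPermOf.ident_comp {r : P.Ops a x} (h : IsPermOf (P.ident x) r) {m : Fin k → ℕ}
    {b : ∀ i, Fin (m i) → P.Colour} (q : ∀ i, P.Ops (b i) (a i)) :
    ∃ i, IsPermOf (q i) (P.comp r q) := by
  obtain ⟨e, h, _, rfl⟩ := h
  obtain rfl : k = 1 := Fin.equiv_iff_eq.mp ⟨e⟩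
  obtain rfl : a = fun _ => x := h
  refine ⟨0, ?_⟩
  dsimp only
  rw [P.reindex_refl_eq _ (Subsingleton.elim _ _)]
  obtain ⟨m, rfl⟩ : ∃ m', m = fun _ => m' := ⟨m 0, funext fun i => by rw [Subsingleton.elim i 0]⟩
  obtain ⟨b, rfl⟩ : ∃ b', b = fun _ => b' := ⟨b 0, funext fun i => by rw [Subsingleton.elim i 0]⟩
  obtain ⟨q, rfl⟩ : ∃ q', q = fun _ => q' := ⟨q 0, funext fun i => by rw [Subsingleton.elim i 0]⟩
  rw [P.ident_comp]
  exact isPermOf_reindex _ _ _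

theorem IsPermOf.eq_of_injective (hc : Function.Injective c) {r r' : P.Ops a x}
    (h : IsPermOf p r) (h' : IsPermOf p r') : r = r' := by
  obtain ⟨e, h, rfl, rfl⟩ := h
  obtain ⟨e', h', _, rfl⟩ := h'
  obtain rfl : e = e' := Equiv.ext fun j => hc (congrFun (h.symm.trans h') j)
  rfl

theorem IsPermOf.ident_eq {r r' : P.Ops a x}
    (h : IsPermOf (P.ident x) r) (h' : IsPermOf (P.ident x) r') : r = r' :=
  h.eq_of_injective (fun _ _ _ => Subsingleton.elim _ _) h'

end IsPermOf

theorem Hom.isPermOf {Q : Operad.{u}} (f : P ⟶ Q) {n k : ℕ} {c : Fin n → P.Colour}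
    {d : P.Colour} {p : P.Ops c d} {a : Fin k → P.Colour} {x : P.Colour} {r : P.Ops a x}
    (h : IsPermOf p r) : IsPermOf (P := Q) (c := f.onColour ∘ c) (d := f.onColour d)
      (a := f.onColour ∘ a) (x := f.onColour x) (f.onOps p) (f.onOps r) := by
  obtain ⟨e, h, rfl, rfl⟩ := h
  exact ⟨e, _, rfl, Hom.onOps_reindex f e h p⟩

/-- The operations which are, up to the order of the inputs, identities or equal to `p`. -/
def IdentOrPermOf {n : ℕ} {c : Fin n → P.Colour} {d : P.Colour} (p : P.Ops c d) {k : ℕ}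
    {a : Fin k → P.Colour} {x : P.Colour} (r : P.Ops a x) : Prop :=
  IsPermOf (P.ident x) r ∨ IsPermOf p r

section IdentOrPermOf

variable {n : ℕ} {c : Fin n → P.Colour} {d : P.Colour} {p : P.Ops c d} {k : ℕ}
    {a : Fin k → P.Colour} {x : P.Colour} {r : P.Ops a x}

theorem IdentOrPermOf.trans (h : IdentOrPermOf p r) {l : ℕ} {b : Fin l → P.Colour}
    {y : P.Colour} {s : P.Ops b y} (h' : IsPermOf r s) : IdentOrPermOf p s := by
  rcases h with h | h
  · obtain ⟨_, _, rfl, _⟩ := id h'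
    exact .inl (h.trans h')
  · exact .inr (h.trans h')

/-- If the output colour of `p` is not an input colour, then no composites can be formed from `p`
alone. -/
theorem opsClosed_identOrPermOf (hd : ∀ i, c i ≠ d) (p : P.Ops c d) :
    P.OpsClosed (fun r => IdentOrPermOf p r) where
  perm hr σ := hr.trans (isPermOf_reindex σ rfl _)
  ident x := .inl (.refl _)
  comp := by
    intro k a x r hr m b q hq
    rcases hr with hr | hr
    · obtain ⟨i, hi⟩ := hr.ident_comp q
      exact (hq i).trans hi
    · refine .inr (hr.comp_ident fun i => (hq i).resolve_right ?_)
      rintro ⟨-, -, hi, -⟩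
      obtain ⟨e, h, -, -⟩ := hr
      exact hd (e i) ((congrFun h i).symm.trans hi.symm)

theorem IdentOrPermOf.eq_of_injective (hd : ∀ i, c i ≠ d) (hc : Function.Injective c)
    {r r' : P.Ops a x} (h : IdentOrPermOf p r) (h' : IdentOrPermOf p r') : r = r' := by
  have key : ∀ {s s' : P.Ops a x}, IsPermOf (P.ident x) s → IsPermOf p s' → False := by
    rintro s s' ⟨e, he, -, -⟩ ⟨e', he', rfl, -⟩
    exact hd (e' (e.symm 0)) ((congrFun he' (e.symm 0)).symm.trans (congrFun he (e.symm 0)))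
  rcases h with h | h <;> rcases h' with h' | h'
  · exact h.ident_eq h'
  · exact (key h h').elim
  · exact (key h' h).elim
  · exact h.eq_of_injective hc h'

end IdentOrPermOf

/-! ### The trivial operad -/

/-- A function on colours extends to a morphism of operads sending every operation to an identity,
provided that the images of the colours permit this. -/
theorem exists_hom_of_ident {Q : Operad.{u}} (f : P.Colour → Q.Colour)
    (hf : ∀ {n : ℕ} {c : Fin n → P.Colour} {d : P.Colour}, P.Ops c d →
      n = 1 ∧ ∀ i, f (c i) = f d) : ∃ g : P ⟶ Q, g.onColour = f := by
  have key : ∀ {n : ℕ} {c : Fin n → P.Colour} {d : P.Colour} (_ : P.Ops c d),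
      ∃ r : Q.Ops (f ∘ c) (f d), IsPermOf (Q.ident (f d)) r := by
    intro n c d p
    obtain ⟨rfl, h⟩ := hf p
    exact ⟨_, isPermOf_reindex (Equiv.refl _) (funext h) _⟩
  choose g hg using @key
  refine ⟨({ onColour := f
             onOps := fun p => g p
             onOps_perm := fun p σ => (hg _).ident_eq ((hg p).perm σ)
             onOps_ident := fun c => (hg _).ident_eq (.refl _)
             onOps_comp := ?_ } : Hom P Q), rfl⟩
  intro n c d p m b q
  exact (hg _).ident_eq ((hg p).comp_ident fun i => hg (q i))

theorem opsClosed_unary : (codiscrete PUnit.{u + 1}).OpsClosed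
    (fun {n} _ _ _ => n = 1) where
  perm hp _ := hp
  ident _ := rfl
  comp := by
    rintro n c d p rfl m b q hq
    simp [hq]

/-- The trivial operad, with one colour and no operation except for the identity. -/
def triv : Operad.{u} := wideSub opsClosed_unary

/-- The unique colour of the trivial operad. -/
def trivC : triv.{u}.Colour := PUnit.unit

theorem isThin_triv : triv.{u}.IsThin := isThin_wideSub_codiscrete _

theorem isRigid_triv : triv.{u}.IsRigid :=
  isRigid_of_isThin isThin_triv fun _ _ _ _ => rfl

theorem triv_arity {n : ℕ} {c : Fin n → triv.{u}.Colour} {d : triv.{u}.Colour}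
    (p : triv.Ops c d) : n = 1 := p.2

theorem hom_triv_ext (f g : P ⟶ triv) : f = g := Hom.ext_of_isThin isThin_triv (funext fun _ => rfl)

theorem exists_colourHom (c : P.Colour) : ∃ f : triv ⟶ P, f.onColour trivC = c := by
  obtain ⟨f, hf⟩ := exists_hom_of_ident (P := triv) (Q := P) (fun _ => c)
    fun p => ⟨triv_arity p, fun _ => rfl⟩
  exact ⟨f, congrFun hf _⟩

theorem triv_isPermOf_ident {n : ℕ} {c : Fin n → triv.{u}.Colour} {d : triv.{u}.Colour}
    (p : triv.Ops c d) : IsPermOf (triv.ident d) p := by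
  obtain rfl := triv_arity p
  exact ⟨Equiv.refl _, rfl, rfl, (isThin_triv _ _).elim _ _⟩

theorem colourHom_ext {f g : triv ⟶ P} (h : f.onColour trivC = g.onColour trivC) : f = g := by
  have hp : ∀ (f : triv ⟶ P) {n : ℕ} {c : Fin n → triv.{u}.Colour} {d : triv.{u}.Colour}
      (p : triv.Ops c d), IsPermOf (P.ident (f.onColour d)) (f.onOps p) := by
    intro f n c d p
    have := Hom.isPermOf f (triv_isPermOf_ident p)
    rwa [f.onOps_ident] at this
  have hf := @hp f
  have hg := @hp g
  obtain ⟨f, f', _, _, _⟩ := f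
  obtain ⟨g, g', _, _, _⟩ := g
  obtain rfl : f = g := funext fun _ => h
  refine Hom.ext rfl (heq_of_eq ?_)
  funext n c d p
  exact (hf p).ident_eq (hg p)

/-- The morphism from the trivial operad that picks the colour `c`. -/
noncomputable def colourHom (c : P.Colour) : triv ⟶ P := (exists_colourHom c).choose

@[simp]
theorem colourHom_onColour (c : P.Colour) (x : triv.Colour) : (colourHom c).onColour x = c :=
  (exists_colourHom c).choose_spec

/-! ### Corollas -/

/-- The colours of the corolla with `n` inputs. -/
inductive CorollaColour (n : ℕ) : Type u
  | inp (i : Fin n) : CorollaColour n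
  | out : CorollaColour n

open CorollaColour

theorem inp_injective (n : ℕ) : Function.Injective (inp.{u} (n := n)) := fun _ _ h => by
  cases h; rfl

/-- The function on colours of a corolla with the given values. -/
def corollaColouring {C : Type u} {n : ℕ} (c : Fin n → C) (d : C) : CorollaColour.{u} n → C
  | inp i => c i
  | out => d

/-- The corolla with `n` inputs: the operad freely generated by one operation whose `n` input
colours and output colour are all distinct. -/
def corolla (n : ℕ) : Operad.{u} :=
  wideSub (opsClosed_identOrPermOf (P := codiscrete (CorollaColour.{u} n)) (c := inp) (d := out)
    nofun ⟨⟩)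

/-- The input colours of a corolla. -/
def inC {n : ℕ} (i : Fin n) : (corolla.{u} n).Colour := CorollaColour.inp i

/-- The output colour of a corolla. -/
def outC {n : ℕ} : (corolla.{u} n).Colour := CorollaColour.out

theorem inC_injective (n : ℕ) : Function.Injective (inC.{u} (n := n)) := inp_injective n

theorem inC_ne_outC {n : ℕ} (i : Fin n) : inC.{u} i ≠ outC := nofun

theorem corolla_colour_cases {n : ℕ} {motive : (corolla.{u} n).Colour → Prop}
    (inC : ∀ i, motive (inC i)) (outC : motive outC) (x : (corolla.{u} n).Colour) : motive x := by
  rcases x with i | _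
  exacts [inC i, outC]

theorem isThin_corolla (n : ℕ) : (corolla.{u} n).IsThin := isThin_wideSub_codiscrete _

/-- The generating operation of a corolla. -/
def gen (n : ℕ) : (corolla.{u} n).Ops (n := n) inC outC := ⟨⟨⟩, .inr (.refl _)⟩

theorem corolla_ops {n k : ℕ} {a : Fin k → (corolla.{u} n).Colour} {x : (corolla.{u} n).Colour}
    (r : (corolla n).Ops a x) : IdentOrPermOf (P := corolla n) (gen n) r := by
  rcases r.2 with ⟨e, h, hd, -⟩ | ⟨e, h, hd, -⟩
  · exact .inl ⟨e, h, hd, (isThin_corolla n _ _).elim _ _⟩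
  · exact .inr ⟨e, h, hd, (isThin_corolla n _ _).elim _ _⟩

theorem isRigid_corolla (n : ℕ) : (corolla.{u} n).IsRigid := by
  refine isRigid_of_isThin (isThin_corolla n) ?_
  rintro a b ⟨p⟩ ⟨q⟩
  rcases corolla_ops p with ⟨e, h, hd, -⟩ | ⟨e, h, hd, -⟩
  · exact congrFun h 0
  rcases corolla_ops q with ⟨e', h', hd', -⟩ | ⟨e', h', hd', -⟩
  · exact (congrFun h' 0).symm
  · exact hd'.symm.trans hd

theorem exists_corollaHom {n : ℕ} {c : Fin n → P.Colour} {d : P.Colour} (p : P.Ops c d) :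
    ∃ f : corolla.{u} n ⟶ P, f.onColour = (corollaColouring c d : CorollaColour.{u} n → _) ∧ f.onOps (gen n) ≍ p := by
  let E := P.pullback (corollaColouring c d)
  let p' : E.Ops (n := n) inp out := p
  have hd : ∀ i : Fin n, inp.{u} i ≠ out := nofun
  have key : ∀ {k : ℕ} {a : Fin k → CorollaColour.{u} n} {x : CorollaColour.{u} n}
      (_ : (corolla n).Ops a x), ∃ r : E.Ops a x, IdentOrPermOf p' r := by
    intro k a x r
    rcases corolla_ops r with ⟨e, h, -, -⟩ | ⟨e, h, rfl, -⟩
    · exact ⟨_, .inl (isPermOf_reindex (P := E) e h _)⟩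
    · exact ⟨_, .inr (isPermOf_reindex (P := E) e h _)⟩
  have uniq : ∀ {k : ℕ} {a : Fin k → CorollaColour.{u} n} {x : CorollaColour.{u} n}
      {r s : E.Ops a x}, IdentOrPermOf p' r → IdentOrPermOf p' s → r = s :=
    fun h h' => h.eq_of_injective hd (inp_injective n) h'
  have hcl := opsClosed_identOrPermOf (P := E) hd p'
  choose g hg using @key
  let f : corolla n ⟶ E := ({
    onColour := fun x => x
    onOps := fun r => g r
    onOps_perm := fun r σ => uniq (hg _) (hcl.perm (hg r) σ)
    onOps_ident := fun x => uniq (hg _) (hcl.ident x)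
    onOps_comp := fun r _ _ s => uniq (hg _) (hcl.comp (hg r) fun i => hg (s i)) } :
      Hom (corolla n) E)
  refine ⟨f ≫ P.pullbackHom (corollaColouring c d), rfl, heq_of_eq ?_⟩
  exact uniq (hg (gen n)) (.inr (.refl p'))

theorem corolla_hom_ext {n : ℕ} {f g : corolla.{u} n ⟶ P} (h : f.onColour = g.onColour)
    (h' : f.onOps (gen n) ≍ g.onOps (gen n)) : f = g := by
  have hf := @Hom.onOps_reindex _ _ f
  have hg := @Hom.onOps_reindex _ _ g
  have hf' := f.onOps_ident
  have hg' := g.onOps_ident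
  obtain ⟨f, f', _, _, _⟩ := f
  obtain ⟨g, g', _, _, _⟩ := g
  obtain rfl : f = g := h
  dsimp only at h' hf hg hf' hg'
  refine Hom.ext rfl (heq_of_eq ?_)
  funext k a x r
  dsimp only
  rcases corolla_ops r with ⟨e, ha, -, rfl⟩ | ⟨e, ha, rfl, rfl⟩
  · rw [hf, hg, hf', hg']
  · exact (hf e ha (gen n)).trans ((congrArg _ (eq_of_heq h')).trans (hg e ha (gen n)).symm)

end Operad

namespace Operad

variable {P Q : Operad.{u}}

@[simp]
theorem comp_onColour {R : Operad.{u}} (f : P ⟶ Q) (g : Q ⟶ R) (c : P.Colour) :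
    (f ≫ g).onColour c = g.onColour (f.onColour c) := rfl

@[simp]
theorem id_onColour (c : P.Colour) : Hom.onColour (𝟙 P) c = c := rfl

/-! ### Operations as morphisms out of corollas -/

section opHom

variable {n : ℕ} {c : Fin n → P.Colour} {d : P.Colour}

/-- The morphism from a corolla classifying the operation `p`. -/
noncomputable def opHom (p : P.Ops c d) : corolla.{u} n ⟶ P := (exists_corollaHom p).choose

@[simp]
theorem opHom_inC (p : P.Ops c d) (i : Fin n) : (opHom p).onColour (inC i) = c i :=
  congrFun (exists_corollaHom p).choose_spec.1 (.inp i)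

@[simp]
theorem opHom_outC (p : P.Ops c d) : (opHom p).onColour outC = d :=
  congrFun (exists_corollaHom p).choose_spec.1 .out

theorem opHom_gen (p : P.Ops c d) : (opHom p).onOps (gen n) ≍ p :=
  (exists_corollaHom p).choose_spec.2

theorem opHom_onOps_gen (g : corolla.{u} n ⟶ P) : opHom (g.onOps (gen n)) = g := by
  refine corolla_hom_ext ?_ (opHom_gen _)
  funext x
  induction x using corolla_colour_cases with
  | inC i => exact opHom_inC _ i
  | outC => exact opHom_outC _

/-- Every operation is the image of the generator of a corolla under a morphism. -/
theorem ops_induction {motive : ∀ (c : Fin n → P.Colour) (d : P.Colour), P.Ops c d → Prop}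
    (h : ∀ g : corolla.{u} n ⟶ P,
      motive (fun i => g.onColour (inC i)) (g.onColour outC) (g.onOps (gen n)))
    (p : P.Ops c d) : motive c d p := by
  have key : ∀ (c' : Fin n → P.Colour) (d' : P.Colour) (p' : P.Ops c' d'), c' = c → d' = d →
      p' ≍ p → motive c' d' p' → motive c d p := by
    rintro c' d' p' rfl rfl hp h
    rwa [← eq_of_heq hp]
  exact key _ _ _ (funext (opHom_inC p)) (opHom_outC p) (opHom_gen p) (h (opHom p))

theorem opHom_comp (p : P.Ops c d) (f : P ⟶ Q) :
    opHom p ≫ f = opHom (P := Q) (c := f.onColour ∘ c) (d := f.onColour d) (f.onOps p) := by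
  induction p using ops_induction with
  | h g =>
    rw [opHom_onOps_gen]
    exact (opHom_onOps_gen (g ≫ f)).symm

theorem opHom_congr {c' : Fin n → P.Colour} {d' : P.Colour} {p : P.Ops c d} {p' : P.Ops c' d'}
    (h : opHom p = opHom p') : c = c' ∧ d = d' ∧ p ≍ p' := by
  refine ⟨?_, ?_, ?_⟩
  · funext i
    rw [← opHom_inC p, h, opHom_inC]
  · rw [← opHom_outC p, h, opHom_outC]
  · refine (opHom_gen p).symm.trans (HEq.trans ?_ (opHom_gen p'))
    rw [h]

theorem opHom_injective {p p' : P.Ops c d} (h : opHom p = opHom p') : p = p' :=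
  eq_of_heq (opHom_congr h).2.2

theorem exists_opHom_eq (g : corolla.{u} n ⟶ P) (hc : ∀ i, g.onColour (inC i) = c i)
    (hd : g.onColour outC = d) : ∃ p : P.Ops c d, opHom p = g := by
  obtain rfl : (fun i => g.onColour (inC i)) = c := funext hc
  subst hd
  exact ⟨_, opHom_onOps_gen g⟩

theorem opHom_perm (p : P.Ops c d) (σ : Equiv.Perm (Fin n)) :
    opHom (P.perm p σ) = opHom ((corolla n).perm (gen n) σ) ≫ opHom p := by
  induction p using ops_induction with
  | h g =>
    rw [opHom_onOps_gen, opHom_comp, Hom.onOps_perm]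

/-- The classifying morphism of a composite depends only on those of its parts. This allows to compare
composites in types of operations which are equal, but not by definition. -/
theorem opHom_comp_congr {c' : Fin n → P.Colour} {d' : P.Colour} {p : P.Ops c d}
    {p' : P.Ops c' d'} (h : opHom p = opHom p') {m : Fin n → ℕ}
    {b b' : ∀ i, Fin (m i) → P.Colour} {q : ∀ i, P.Ops (b i) (c i)}
    {q' : ∀ i, P.Ops (b' i) (c' i)} (hq : ∀ i, opHom (q i) = opHom (q' i)) :
    opHom (P.comp p q) = opHom (P.comp p' q') := by
  obtain ⟨rfl, rfl, hp⟩ := opHom_congr h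
  obtain rfl := eq_of_heq hp
  obtain rfl : b = b' := funext fun i => (opHom_congr (hq i)).1
  obtain rfl : q = q' := funext fun i => opHom_injective (hq i)
  rfl

end opHom

theorem opHom_ident (c : P.Colour) :
    opHom (P.ident c) = opHom (triv.ident trivC) ≫ colourHom c := by
  rw [opHom_comp, Hom.onOps_ident]
  exact congrArg (fun c => opHom (P.ident c)) (colourHom_onColour c trivC).symm

/-- Corollas are jointly separating. -/
theorem hom_ext_of_corolla {f g : P ⟶ Q}
    (h : ∀ {n : ℕ} (k : corolla.{u} n ⟶ P), k ≫ f = k ≫ g) : f = g := by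
  have hcol : f.onColour = g.onColour := by
    funext c
    have := congrArg (fun k => Hom.onColour k outC) (h (opHom (P.ident c)))
    simpa only [comp_onColour, opHom_outC] using this
  have hop : ∀ {n : ℕ} {c : Fin n → P.Colour} {d : P.Colour} (p : P.Ops c d),
      f.onOps p ≍ g.onOps p := by
    intro n c d p
    have := h (opHom p)
    rw [opHom_comp, opHom_comp] at this
    exact (opHom_congr this).2.2
  obtain ⟨f, f', _, _, _⟩ := f
  obtain ⟨g, g', _, _, _⟩ := g
  obtain rfl : f = g := hcol
  refine Hom.ext rfl (heq_of_eq ?_)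
  funext n c d p
  exact eq_of_heq (hop p)

/-- A morphism that is bijective on colours and on operations is an isomorphism. -/
theorem isIso_of_bijective (f : P ⟶ Q) (hf : Function.Bijective f.onColour)
    (hf' : ∀ {n : ℕ} (c : Fin n → P.Colour) (d : P.Colour),
      Function.Bijective (fun p : P.Ops c d => f.onOps p)) : IsIso f := by
  obtain ⟨e, he⟩ : ∃ e : P.Colour ≃ Q.Colour, ⇑e = f.onColour :=
    ⟨Equiv.ofBijective _ hf, rfl⟩
  have hopex : ∀ {n : ℕ} {c : Fin n → Q.Colour} {d : Q.Colour} (r : Q.Ops c d),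
      ∃ p : P.Ops (e.symm ∘ c) (e.symm d), opHom p ≫ f = opHom r := by
    intro n c d r
    obtain ⟨c, rfl⟩ : ∃ c', c = f.onColour ∘ c' := ⟨e.symm ∘ c, by rw [← he]; ext; simp⟩
    obtain ⟨d, rfl⟩ : ∃ d', d = f.onColour d' := ⟨e.symm d, by rw [← he]; simp⟩
    obtain ⟨p, rfl⟩ := (hf' c d).2 r
    obtain ⟨p', hp'⟩ := exists_opHom_eq (c := e.symm ∘ (f.onColour ∘ c))
      (d := e.symm (f.onColour d)) (opHom p) (by simp [← he]) (by simp [← he])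
    refine ⟨p', ?_⟩
    rw [hp', opHom_comp]
  choose g hg using @hopex
  have hinj : ∀ {n : ℕ} {c : Fin n → P.Colour} {d : P.Colour} {p p' : P.Ops c d},
      opHom p ≫ f = opHom p' ≫ f → p = p' := by
    intro n c d p p' h
    rw [opHom_comp, opHom_comp] at h
    exact (hf' c d).1 (opHom_injective h)
  have hcanc : ∀ {n : ℕ} {k k' : corolla.{u} n ⟶ P}, k ≫ f = k' ≫ f → k = k' := by
    intro n k k' h
    obtain ⟨c, d, p, rfl⟩ : ∃ (c : Fin n → P.Colour) (d : P.Colour) (p : P.Ops c d), opHom p = k :=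
      ⟨_, _, _, opHom_onOps_gen k⟩
    have hcol : k'.onColour = (opHom p).onColour := by
      funext x
      exact hf.1 (congrFun (congrArg Hom.onColour h) x).symm
    obtain ⟨p', rfl⟩ := exists_opHom_eq (c := c) (d := d) k' (fun i => (congrFun hcol (inC i)).trans (opHom_inC _ i))
      ((congrFun hcol outC).trans (opHom_outC _))
    rw [hinj h]
  let G : Q ⟶ P := ({
    onColour := e.symm
    onOps := fun r => g r
    onOps_perm := fun r σ => hinj (by
      rw [hg, opHom_perm r, opHom_perm (g r), Category.assoc, hg])
    onOps_ident := fun c => hinj (by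
      rw [hg, opHom_comp, Hom.onOps_ident]
      have : c = f.onColour (e.symm c) := by rw [← he]; simp
      exact congrArg (fun c => opHom (Q.ident c)) this)
    onOps_comp := fun r _ _ s => hinj (by
      rw [hg, opHom_comp, Hom.onOps_comp]
      refine opHom_comp_congr ?_ fun i => ?_
      · rw [← opHom_comp, hg]
      · exact (hg (s i)).symm.trans (opHom_comp _ _)) } : Hom Q P)
  have hG : ∀ {n : ℕ} (k : corolla.{u} n ⟶ Q), (k ≫ G) ≫ f = k := by
    intro n k
    rw [← opHom_onOps_gen k, opHom_comp]
    exact hg _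
  refine ⟨G, ?_, ?_⟩
  · refine hom_ext_of_corolla fun k => hcanc ?_
    simpa using hG (k ≫ f)
  · refine hom_ext_of_corolla fun k => ?_
    simpa using hG k

/-! ### Morphisms between corollas -/

theorem arity_of_corolla_hom_triv {n : ℕ} (f : corolla.{u} n ⟶ triv) : n = 1 :=
  triv_arity (f.onOps (gen n))

theorem exists_hom_triv (h : ∀ n : ℕ, n ≠ 1 → IsEmpty (corolla.{u} n ⟶ P)) :
    Nonempty (P ⟶ triv) := by
  obtain ⟨f, -⟩ := exists_hom_of_ident (P := P) (Q := triv) (fun _ => trivC)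
    fun {n} _ _ p => ⟨by_contra fun hn => (h n hn).false (opHom p), fun _ => rfl⟩
  exact ⟨f⟩

/-- A morphism between corollas is either constant on colours, or a bijection respecting inputs
and output. -/
theorem corolla_hom_cases {k n : ℕ} (f : corolla.{u} k ⟶ corolla n) :
    (k = 1 ∧ ∀ x, f.onColour x = f.onColour outC) ∨
      (f.onColour outC = outC ∧ ∃ e : Fin k ≃ Fin n, ∀ i, f.onColour (inC i) = inC (e i)) := by
  rcases corolla_ops (f.onOps (gen k)) with ⟨e, h, -, -⟩ | ⟨e, h, hd, -⟩
  · refine .inl ⟨Fin.equiv_iff_eq.mp ⟨e⟩, ?_⟩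
    intro x
    induction x using corolla_colour_cases with
    | inC i => exact congrFun h i
    | outC => rfl
  · exact .inr ⟨hd.symm, e, fun i => congrFun h i⟩

theorem isIso_corolla_endo {n : ℕ} (f : corolla.{u} n ⟶ corolla n)
    (h : n ≠ 1 ∨ ∃ x, f.onColour x ≠ f.onColour outC) : IsIso f := by
  rcases corolla_hom_cases f with ⟨hn, hc⟩ | ⟨ho, e, he⟩
  · obtain h | ⟨x, h⟩ := h
    exacts [(h hn).elim, (h (hc x)).elim]
  · refine ⟨opHom ((corolla n).perm (gen n) e.symm), ?_, ?_⟩ <;>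
    · refine Hom.ext_of_isThin (isThin_corolla n) ?_
      funext x
      induction x using corolla_colour_cases with
      | inC i => simp [he]
      | outC => simp [ho]

end Operad

namespace Operad

variable {P Q : Operad.{u}}

/-! ### An operad with nullary operations -/

theorem opsClosed_implication : (codiscrete (ULift.{u} Bool)).OpsClosed
    (fun {_} (c : _ → ULift Bool) d _ => (∀ i, c i = ⟨true⟩) → d = ⟨true⟩) where
  perm {n c d p} hp σ h := hp fun i => by simpa using h (σ.symm i)
  ident c h := h 0
  comp {n c d p} hp m b q hq h := hp fun i => hq i fun j => by
    rw [← h (splitIdx.symm ⟨i, j⟩)]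
    exact (concatTuple_symm b ⟨i, j⟩).symm

/-- The thin operad whose colours are truth values, with an operation of type `(c₁, …, cₙ; d)` if
and only if `c₁, …, cₙ` imply `d`. -/
def implication : Operad.{u} := wideSub opsClosed_implication

theorem isRigid_implication : implication.{u}.IsRigid := by
  refine isRigid_of_isThin (isThin_wideSub_codiscrete _) ?_
  rintro ⟨a⟩ ⟨b⟩ ⟨p⟩ ⟨q⟩
  have hp := fun h => congrArg ULift.down (p.2 fun _ => congrArg ULift.up h)
  have hq := fun h => congrArg ULift.down (q.2 fun _ => congrArg ULift.up h)
  exact congrArg ULift.up (Bool.eq_iff_iff.mpr ⟨hp, hq⟩)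

/-- The colour of `implication` given by a truth value. -/
def truth (b : Bool) : implication.{u}.Colour := ULift.up b

theorem nonempty_nullary_true (c : Fin 0 → implication.{u}.Colour) :
    Nonempty (implication.Ops c (truth true)) :=
  ⟨⟨⟨⟩, fun _ => rfl⟩⟩

theorem isEmpty_nullary_false (c : Fin 0 → implication.{u}.Colour) :
    IsEmpty (implication.Ops c (truth false)) :=
  ⟨fun p => Bool.false_ne_true (congrArg ULift.down (p.2 nofun))⟩

theorem nonempty_false_true :
    Nonempty (implication.{u}.Unary (truth false) (truth true)) :=
  ⟨⟨⟨⟩, fun _ => rfl⟩⟩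

/-! ### Grafting two levels of corollas -/

section Absorbing

variable {ar : P.Colour → ℕ} {lv : ∀ x, Fin (ar x) → P.Colour} (e : ∀ x, P.Ops (lv x) x)
  (ht : P.Colour → ℕ)

/-- Given a chosen operation `e x` with each output colour `x` and a height function on the
colours, the operations `r` into `d` such that plugging the chosen operations into `r` gives the
chosen operation `e d`, up to the order of the inputs, and such that each input of `r` is either
`d` itself or of smaller height. -/
def Absorbs {n : ℕ} {c : Fin n → P.Colour} {d : P.Colour} (r : P.Ops c d) : Prop :=
  (∀ i, c i = d ∨ ht (c i) < ht d) ∧ IsPermOf (e d) (P.comp r fun i => e (c i))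

theorem opsClosed_absorbs : P.OpsClosed (Absorbs e ht) where
  perm {n c d p} hp σ := by
    exact ⟨fun i => hp.1 (σ i), hp.2.trans (.of_eq (P.perm_comp p (fun i => e (c i)) σ))⟩
  ident x := by
    refine ⟨fun _ => .inl rfl, ?_⟩
    rw [P.ident_comp]
    exact isPermOf_reindex _ _ _
  comp {n c d p} hp m b q hq := by
    refine ⟨fun k => ?_, ?_⟩
    · have h1 := (hq (splitIdx k).1).1 (splitIdx k).2
      have h2 := hp.1 (splitIdx k).1
      change b _ _ = d ∨ ht (b _ _) < ht d
      rcases h2 with h2 | h2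
      · rwa [h2] at h1
      · rcases h1 with h1 | h1
        · exact .inr (h1 ▸ h2)
        · exact .inr (h1.trans h2)
    · refine hp.2.trans ((IsPermOf.comp p fun i => (hq i).2).trans ?_)
      exact .of_eq (P.comp_assoc p q (fun i j => e (b i j)))

/-- The suboperad of the operations satisfying `Absorbs`. -/
def absorbing : Operad.{u} := wideSub (opsClosed_absorbs e ht)

end Absorbing

/-- The edges of the tree of height two whose root vertex has `n` inputs, with a vertex with `m i`
inputs on top of the `i`-th input. -/
inductive Edge {n : ℕ} (m : Fin n → ℕ) : Type u
  | leaf (i : Fin n) (j : Fin (m i)) : Edge m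
  | inner (i : Fin n) : Edge m
  | root : Edge m

namespace Edge

variable {n : ℕ} {m : Fin n → ℕ}

/-- The number of leaves above an edge. -/
def arity : Edge.{u} m → ℕ
  | leaf _ _ => 1
  | inner i => m i
  | root => ∑ i, m i

/-- The leaves above an edge. -/
def leaves : ∀ x : Edge.{u} m, Fin x.arity → Edge.{u} m
  | leaf i j => fun _ => leaf i j
  | inner i => leaf i
  | root => concatTuple leaf

/-- The height of an edge above the leaves. -/
def height : Edge.{u} m → ℕ
  | leaf _ _ => 0
  | inner _ => 1
  | root => 2

theorem concatTuple_leaf_injective :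
    Function.Injective (concatTuple (leaf.{u} (m := m))) := by
  intro k l h
  apply splitIdx.injective
  change leaf (splitIdx k).1 (splitIdx k).2 = leaf (splitIdx l).1 (splitIdx l).2 at h
  generalize splitIdx k = s at *
  generalize splitIdx l = t at *
  obtain ⟨s, s'⟩ := s
  obtain ⟨t, t'⟩ := t
  cases h
  rfl

variable {c : Fin n → P.Colour} {d : P.Colour} {b : ∀ i, Fin (m i) → P.Colour}

/-- The colouring of the edges by given tuples of colours. -/
def colouring (b : ∀ i, Fin (m i) → P.Colour) (c : Fin n → P.Colour) (d : P.Colour) :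
    Edge.{u} m → P.Colour
  | leaf i j => b i j
  | inner i => c i
  | root => d

/-- The evaluation of the part of the tree above an edge, when the vertices are labelled by `p`
and the `q i`. -/
def eval (p : P.Ops c d) (q : ∀ i, P.Ops (b i) (c i)) :
    ∀ x : Edge.{u} m, (P.pullback (colouring b c d)).Ops x.leaves x
  | leaf i j => P.ident (b i j)
  | inner i => q i
  | root => P.comp p q

end Edge

section Grafting

open Edge

variable {n : ℕ} {c : Fin n → P.Colour} {d : P.Colour} (p : P.Ops c d) {m : Fin n → ℕ}
  {b : ∀ i, Fin (m i) → P.Colour} (q : ∀ i, P.Ops (b i) (c i))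

/-- The operad over `P` with the edges of a tree as colours that contains the vertices `p` and `q i`
of the tree and in which the composite of the whole tree is the only operation from the leaves to
the root. -/
def grafting : Operad.{u} := absorbing (P := P.pullback (colouring b c d)) (Edge.eval p q) height

/-- The colour of `grafting p q` given by an edge. -/
def edgeC (x : Edge.{u} m) : (grafting p q).Colour := x

/-- The projection to the original operad. -/
def graftingHom : grafting p q ⟶ P := wideSubHom _ ≫ P.pullbackHom _

theorem isRigid_grafting (hP : P.IsRigid) : (grafting p q).IsRigid := by
  intro x y r hr
  have hr' := Hom.isInvertible (graftingHom p q) hr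
  obtain ⟨s, -, -⟩ := hr
  have h1 := r.2.1 0
  have h2 := s.2.1 0
  -- If a vertex is labelled by an identity, then two distinct edges are related by an identity of `P`.
  -- The height condition ensures that its inverse is not an operation of the grafting.
  obtain rfl : x = y := by
    rcases h1 with h1 | h1
    · exact h1
    · rcases h2 with h2 | h2
      · exact h2.symm
      · exact (lt_asymm h1 h2).elim
  have key : ∀ {a b : P.Colour} (p : P.Unary a b), P.IsIdentity p → p ≍ P.ident a := by
    rintro a b p ⟨⟩
    rfl
  have h3 := eq_of_heq (key _ (hP _ hr'))
  obtain rfl : r = (grafting p q).ident x := Subtype.ext h3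
  exact .ident x

/-- The root vertex of a grafting. -/
def rootOp : (grafting p q).Ops (fun i => edgeC p q (inner i)) (edgeC p q root) :=
  ⟨p, fun _ => .inr Nat.one_lt_two, IsPermOf.refl (P := P.pullback (colouring b c d)) (eval p q root)⟩

/-- The upper vertices of a grafting. -/
def upperOp (i : Fin n) :
    (grafting p q).Ops (fun j => edgeC p q (leaf i j)) (edgeC p q (inner i)) :=
  ⟨q i, fun _ => .inr Nat.zero_lt_one, by
    exact .of_eq ((P.pullback (colouring b c d)).comp_ident (c := leaf i) (d := inner i) (q i))⟩

theorem subsingleton_grafting_ops :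
    Subsingleton ((grafting p q).Ops (concatTuple fun i j => edgeC p q (leaf i j))
      (edgeC p q root)) := by
  have key : ∀ r : (grafting p q).Ops (concatTuple fun i j => edgeC p q (leaf i j))
      (edgeC p q root), IsPermOf (P := P.pullback (colouring b c d)) (eval p q root) r.1 := by
    intro r
    have h := r.2.2
    have h' := (P.pullback (colouring b c d)).comp_ident (c := concatTuple leaf) (d := root) r.1
    exact h.trans (IsPermOf.of_eq h').symm
  exact ⟨fun r s => Subtype.ext ((key r).eq_of_injective concatTuple_leaf_injective (key s))⟩

end Grafting

end Operad

namespace Operad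

/-! ### Autoequivalences and colours -/

/-- A class of operads that contains the rigid operads and is closed under `grafting`. -/
class IsGraftingClosed (Φ : ObjectProperty Operad.{u}) : Prop where
  of_isRigid (P : Operad.{u}) (hP : P.IsRigid) : Φ P
  grafting {P : Operad.{u}} (hP : Φ P) {n : ℕ} {c : Fin n → P.Colour} {d : P.Colour}
    (p : P.Ops c d) {m : Fin n → ℕ} {b : ∀ i, Fin (m i) → P.Colour}
    (q : ∀ i, P.Ops (b i) (c i)) : Φ (grafting p q)

/-- Nullary operations can be composed with unary operations. -/
theorem nonempty_nullary {P : Operad.{u}} {c : Fin 0 → P.Colour} {a b : P.Colour}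
    (r : P.Unary a b) (s : P.Ops c a) : Nonempty (P.Ops c b) :=
  ⟨P.reindex (singleIdx 0).symm (Subsingleton.elim _ _)
    (P.comp r (m := fun _ => 0) (b := fun _ => c) fun _ => s)⟩

variable {Φ : ObjectProperty Operad.{u}}

/-- Two morphisms that are inverse to each other up to automorphisms are isomorphisms. -/
theorem isIso_of_isIso_comp {C : Type*} [Category C] {X Y : C} (f : X ⟶ Y) (g : Y ⟶ X)
    [IsIso (f ≫ g)] [IsIso (g ≫ f)] : IsIso f := by
  have : IsSplitMono f := .mk' ⟨g ≫ inv (f ≫ g), by simp [← Category.assoc]⟩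
  have : IsSplitEpi f := .mk' ⟨inv (g ≫ f) ≫ g, by simp⟩
  exact isIso_of_mono_of_isSplitEpi f

theorem isIso_of_isIso_hom {X Y : Φ.FullSubcategory} (f : X ⟶ Y) (h : IsIso f.hom) : IsIso f :=
  (ObjectProperty.isIso_hom_iff f).mp h

theorem onColour_bijective_of_isIso {X Y : Φ.FullSubcategory} (f : X ⟶ Y) [IsIso f] :
    Function.Bijective f.hom.onColour := by
  refine Function.bijective_iff_has_inverse.mpr ⟨(inv f).hom.onColour, fun x => ?_, fun x => ?_⟩
  · exact congrArg (fun g => g.hom.onColour x) (IsIso.hom_inv_id f)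
  · exact congrArg (fun g => g.hom.onColour x) (IsIso.inv_hom_id f)

theorem isIso_map_endo (F : Φ.FullSubcategory ⥤ Φ.FullSubcategory) [F.IsEquivalence]
    {X : Φ.FullSubcategory} (h : ∀ f : X ⟶ X, IsIso f) (f : F.obj X ⟶ F.obj X) : IsIso f := by
  rw [← F.map_preimage f]
  have := h (F.preimage f)
  infer_instance

variable [IsGraftingClosed Φ]

variable (Φ) in
/-- The trivial operad as an object of a full subcategory. -/
abbrev trivObj : Φ.FullSubcategory := ⟨triv, IsGraftingClosed.of_isRigid _ isRigid_triv⟩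

variable (Φ) in
/-- The corolla with `n` inputs as an object of a full subcategory. -/
abbrev corollaObj (n : ℕ) : Φ.FullSubcategory :=
  ⟨corolla n, IsGraftingClosed.of_isRigid _ (isRigid_corolla n)⟩

theorem trivObj_hom_ext {X : Φ.FullSubcategory} (f g : X ⟶ trivObj Φ) : f = g :=
  ObjectProperty.hom_ext _ (hom_triv_ext _ _)

section

variable (F : Φ.FullSubcategory ⥤ Φ.FullSubcategory) [F.IsEquivalence]

theorem nonempty_trivObj_hom : Nonempty (trivObj Φ ⟶ F.obj (trivObj Φ)) := by
  by_contra h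
  have hE : IsEmpty (F.obj (trivObj Φ)).obj.Colour :=
    ⟨fun c => h ⟨ObjectProperty.homMk (colourHom c)⟩⟩
  -- An operad without colours has no operations, so it has at most one morphism to any operad.
  have hs : ∀ {Y : Φ.FullSubcategory} (f g : F.obj (trivObj Φ) ⟶ Y), f = g := by
    intro Y f g
    refine ObjectProperty.hom_ext _ (hom_ext_of_corolla fun k => ?_)
    exact hE.elim (k.onColour outC)
  have := F.map_injective (hs (F.map (ObjectProperty.homMk (Y := corollaObj Φ 1)
    (colourHom (inC 0)))) (F.map (ObjectProperty.homMk (colourHom outC))))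
  have h' := congrArg (fun f => f.hom.onColour trivC) this
  exact inC_ne_outC (n := 1) 0 (by simpa using h')

theorem nonempty_trivObj_iso : Nonempty (trivObj Φ ≅ F.obj (trivObj Φ)) := by
  obtain ⟨f⟩ := nonempty_trivObj_hom F
  obtain ⟨g⟩ := nonempty_trivObj_hom F.inv
  let g' : F.obj (trivObj Φ) ⟶ trivObj Φ := F.map g ≫ F.asEquivalence.counit.app _
  refine ⟨⟨f, g', trivObj_hom_ext _ _, ?_⟩⟩
  rw [← F.map_preimage (g' ≫ f), trivObj_hom_ext (F.preimage (g' ≫ f)) (𝟙 _), F.map_id]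

/-- The isomorphism between the trivial operad and its image under an autoequivalence. -/
noncomputable def trivIso : trivObj Φ ≅ F.obj (trivObj Φ) := (nonempty_trivObj_iso F).some

/-- The action of an autoequivalence on colours, regarded as morphisms from the trivial operad. -/
noncomputable def mapColour {X : Φ.FullSubcategory} (c : X.obj.Colour) : (F.obj X).obj.Colour :=
  ((trivIso F).hom ≫ F.map (ObjectProperty.homMk (colourHom c))).hom.onColour trivC

theorem mapColour_naturality {X Y : Φ.FullSubcategory} (f : X ⟶ Y) (c : X.obj.Colour) :
    (F.map f).hom.onColour (mapColour F c) = mapColour F (f.hom.onColour c) := by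
  have : ObjectProperty.homMk (X := trivObj Φ) (colourHom c) ≫ f =
      ObjectProperty.homMk (colourHom (f.hom.onColour c)) :=
    ObjectProperty.hom_ext _ (colourHom_ext (by simp))
  rw [mapColour, mapColour, ← this]
  simp

theorem mapColour_injective (X : Φ.FullSubcategory) :
    Function.Injective (mapColour F (X := X)) := by
  intro c d h
  have h1 := ObjectProperty.hom_ext _ (colourHom_ext h)
  rw [cancel_epi] at h1
  have h2 := congrArg (fun f => f.hom.onColour trivC) (F.map_injective h1)
  simpa using h2

theorem mapColour_bijective (X : Φ.FullSubcategory) :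
    Function.Bijective (mapColour F (X := X)) := by
  refine ⟨mapColour_injective F X, fun y => ?_⟩
  let g : F.obj (trivObj Φ) ⟶ F.obj X :=
    (trivIso F).inv ≫ ObjectProperty.homMk (colourHom y)
  refine ⟨(F.preimage g).hom.onColour trivC, ?_⟩
  have h : ObjectProperty.homMk (X := trivObj Φ)
      (colourHom ((F.preimage g).hom.onColour trivC)) = F.preimage g :=
    ObjectProperty.hom_ext _ (colourHom_ext (by simp))
  rw [mapColour, h, F.map_preimage, Iso.hom_inv_id_assoc]
  simp

theorem map_onColour_injective {X Y : Φ.FullSubcategory} {f : X ⟶ Y}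
    (hf : Function.Injective f.hom.onColour) : Function.Injective (F.map f).hom.onColour := by
  intro x y h
  obtain ⟨x, rfl⟩ := (mapColour_bijective F X).2 x
  obtain ⟨y, rfl⟩ := (mapColour_bijective F X).2 y
  rw [mapColour_naturality, mapColour_naturality] at h
  rw [hf (mapColour_injective F Y h)]

theorem onColour_injective_of_map {X Y : Φ.FullSubcategory} {f : X ⟶ Y}
    (hf : Function.Injective (F.map f).hom.onColour) : Function.Injective f.hom.onColour := by
  intro x y h
  refine mapColour_injective F X (hf ?_)
  rw [mapColour_naturality, mapColour_naturality, h]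

/-! ### Autoequivalences and corollas -/

theorem exists_corolla_hom {n : ℕ} (hn : n ≠ 1) :
    ∃ k ≠ 1, Nonempty (corollaObj Φ k ⟶ F.obj (corollaObj Φ n)) := by
  by_contra! h
  obtain ⟨f⟩ := exists_hom_triv (P := (F.obj (corollaObj Φ n)).obj)
    fun k hk => ⟨fun g => (h k hk).false (ObjectProperty.homMk g)⟩
  let f' : F.obj (corollaObj Φ n) ⟶ F.obj (trivObj Φ) :=
    ObjectProperty.homMk f ≫ (trivIso F).hom
  exact hn (arity_of_corolla_hom_triv (F.preimage f').hom)

theorem isIso_corollaObj_endo {n : ℕ} (hn : n ≠ 1) (f : corollaObj Φ n ⟶ corollaObj Φ n) :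
    IsIso f :=
  isIso_of_isIso_hom _ (isIso_corolla_endo f.hom (.inl hn))

/-- Corollas with a different number of inputs can be told apart by the number of colours. -/
theorem eq_of_corolla_equiv {m n : ℕ} (e : (corolla.{u} m).Colour ≃ (corolla.{u} n).Colour) :
    m = n := by
  have h : ∀ k : ℕ, Nonempty ((corolla.{u} k).Colour ≃ Option (Fin k)) := fun k =>
    ⟨{ toFun := fun x => match x with
        | CorollaColour.inp i => some i
        | CorollaColour.out => none
       invFun := fun x => match x with
        | some i => inC i
        | none => outC
       left_inv := fun x => by cases x <;> rfl
       right_inv := fun x => by cases x <;> rfl }⟩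
  obtain ⟨em⟩ := h m
  obtain ⟨en⟩ := h n
  simpa using Fintype.card_congr ((em.symm.trans e).trans en)

theorem nonempty_corollaObj_iso_of_ne {n : ℕ} (hn : n ≠ 1) :
    Nonempty (corollaObj Φ n ≅ F.obj (corollaObj Φ n)) := by
  obtain ⟨m, hm, ⟨f⟩⟩ := exists_corolla_hom F.inv hn
  let f' : F.obj (corollaObj Φ m) ⟶ corollaObj Φ n :=
    F.map f ≫ F.asEquivalence.counit.app _
  obtain ⟨k, hk, ⟨g⟩⟩ := exists_corolla_hom F hm
  obtain rfl : k = n := by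
    rcases corolla_hom_cases (g ≫ f').hom with ⟨h, -⟩ | ⟨-, e, -⟩
    · exact (hk h).elim
    · exact Fin.equiv_iff_eq.mp ⟨e⟩
  have := isIso_corollaObj_endo hn (g ≫ f')
  have := isIso_map_endo F (isIso_corollaObj_endo hm) (f' ≫ g)
  have hg := isIso_of_isIso_comp g f'
  obtain rfl : m = k := eq_of_corolla_equiv
    ((Equiv.ofBijective _ (mapColour_bijective F (corollaObj Φ m))).trans
      (Equiv.ofBijective _ (onColour_bijective_of_isIso g)).symm)
  exact ⟨asIso g⟩

theorem corolla_one_injective {C : Type*} {f : (corolla.{u} 1).Colour → C}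
    (h : f (inC 0) ≠ f outC) : Function.Injective f := by
  intro x y hxy
  induction x using corolla_colour_cases with
  | inC i =>
    obtain rfl := Subsingleton.elim i 0
    induction y using corolla_colour_cases with
    | inC i => rw [Subsingleton.elim i 0]
    | outC => exact (h hxy).elim
  | outC =>
    induction y using corolla_colour_cases with
    | inC i =>
      obtain rfl := Subsingleton.elim i 0
      exact (h hxy.symm).elim
    | outC => rfl

theorem isIso_of_injective {f : corollaObj Φ 1 ⟶ corollaObj Φ 1}
    (h : Function.Injective f.hom.onColour) : IsIso f :=
  isIso_of_isIso_hom _ (isIso_corolla_endo f.hom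
    (.inr ⟨inC 0, fun h' => inC_ne_outC _ (h h')⟩))

/-- If there were no unary operation between distinct colours of the image of the unary corolla,
then the two colours could be swapped by an endomorphism. -/
theorem exists_injective_corolla_hom :
    ∃ f : corollaObj Φ 1 ⟶ F.obj (corollaObj Φ 1), Function.Injective f.hom.onColour := by
  classical
  by_contra! h
  let t : F.obj (corollaObj Φ 1) ⟶ trivObj Φ :=
    F.map (ObjectProperty.homMk (exists_hom_triv (P := corolla 1) fun n hn =>
      ⟨fun f => by
        rcases corolla_hom_cases f with ⟨h, -⟩ | ⟨-, e, -⟩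
        exacts [hn h, hn (Fin.equiv_iff_eq.mp ⟨e⟩)]⟩).some) ≫ (trivIso F).inv
  obtain ⟨g, hg⟩ := exists_hom_of_ident (P := (F.obj (corollaObj Φ 1)).obj)
    (Q := (F.obj (corollaObj Φ 1)).obj)
    (Equiv.swap (mapColour F (X := corollaObj Φ 1) (inC 0))
      (mapColour F (X := corollaObj Φ 1) outC)) (by
      intro n c d p
      obtain rfl := triv_arity (t.hom.onOps p)
      refine ⟨rfl, fun i => ?_⟩
      obtain rfl := Subsingleton.elim i 0
      by_contra hcd
      refine h (ObjectProperty.homMk (opHom p)) (corolla_one_injective ?_)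
      simpa using fun h => hcd (congrArg _ h))
  let g' : F.obj (corollaObj Φ 1) ⟶ F.obj (corollaObj Φ 1) := ObjectProperty.homMk g
  have h1 : (F.preimage g').hom.onColour (inC 0) = outC := mapColour_injective F _ (by
    rw [← mapColour_naturality, F.map_preimage]
    simp [g', hg])
  have h2 : (F.preimage g').hom.onColour outC = inC 0 := mapColour_injective F _ (by
    rw [← mapColour_naturality, F.map_preimage]
    simp [g', hg])
  rcases corolla_hom_cases (F.preimage g').hom with ⟨-, h⟩ | ⟨h, -⟩
  · exact inC_ne_outC _ ((h2.symm.trans (h (inC 0)).symm).trans h1)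
  · exact inC_ne_outC _ (h2.symm.trans h)

theorem nonempty_corollaObj_iso (n : ℕ) :
    Nonempty (corollaObj Φ n ≅ F.obj (corollaObj Φ n)) := by
  by_cases hn : n ≠ 1
  · exact nonempty_corollaObj_iso_of_ne F hn
  obtain rfl := not_not.mp hn
  obtain ⟨f, hf⟩ := exists_injective_corolla_hom F
  obtain ⟨g, hg⟩ := exists_injective_corolla_hom F.inv
  let g' : F.obj (corollaObj Φ 1) ⟶ corollaObj Φ 1 :=
    F.map g ≫ F.asEquivalence.counit.app _
  have hg' : Function.Injective g'.hom.onColour :=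
    (onColour_bijective_of_isIso (F.asEquivalence.counit.app (corollaObj Φ 1))).1.comp
      (map_onColour_injective F hg)
  have : IsIso (f ≫ g') := isIso_of_injective (hg'.comp hf)
  have : IsIso (g' ≫ f) := by
    rw [← F.map_preimage (g' ≫ f)]
    have : IsIso (F.preimage (g' ≫ f)) := isIso_of_injective (onColour_injective_of_map F (by
      rw [F.map_preimage]
      exact hf.comp hg'))
    infer_instance
  have := isIso_of_isIso_comp f g'
  exact ⟨asIso f⟩

theorem corollaObj_hom_ext {X : Φ.FullSubcategory} {n : ℕ} {f g : X ⟶ F.obj (corollaObj Φ n)}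
    (h : f.hom.onColour = g.hom.onColour) : f = g := by
  obtain ⟨θ⟩ := nonempty_corollaObj_iso F n
  rw [← cancel_mono θ.inv]
  refine ObjectProperty.hom_ext _ (Hom.ext_of_isThin (isThin_corolla n) ?_)
  funext x
  exact congrArg θ.inv.hom.onColour (congrFun h x)

/-- An isomorphism that is correct on the output colour can be corrected on the input colours by a
permutation of the inputs. -/
theorem exists_corollaObj_iso_of_outC {n : ℕ} (θ : corollaObj Φ n ≅ F.obj (corollaObj Φ n))
    (hθ : θ.hom.hom.onColour outC = mapColour F (X := corollaObj Φ n) outC) :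
    ∃ θ : corollaObj Φ n ≅ F.obj (corollaObj Φ n),
      ∀ x, θ.hom.hom.onColour x = mapColour F x := by
  have hbij := onColour_bijective_of_isIso θ.hom
  have hex : ∀ i, ∃ j, θ.hom.hom.onColour (inC i) = mapColour F (X := corollaObj Φ n) (inC j) := by
    intro i
    obtain ⟨y, hy⟩ := (mapColour_bijective F (corollaObj Φ n)).2 (θ.hom.hom.onColour (inC i))
    induction y using corolla_colour_cases with
    | inC j => exact ⟨j, hy.symm⟩
    | outC => exact (inC_ne_outC i (hbij.1 (hy.symm.trans hθ.symm))).elim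
  choose e he using hex
  have hinj : Function.Injective e := fun i j hij =>
    inC_injective n (hbij.1 ((he i).trans (hij ▸ (he j).symm)))
  let e' : Equiv.Perm (Fin n) := Equiv.ofBijective e (Finite.injective_iff_bijective.mp hinj)
  let α : corollaObj Φ n ⟶ corollaObj Φ n :=
    ObjectProperty.homMk (opHom ((corolla n).perm (gen n) e'.symm))
  have : IsIso α := isIso_of_isIso_hom _ (isIso_corolla_endo _ (by
    by_cases hn : n = 1
    · subst hn
      exact .inr ⟨inC 0, by simpa [α] using inC_ne_outC _⟩
    · exact .inl hn))
  refine ⟨asIso α ≪≫ θ, fun x => ?_⟩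
  induction x using corolla_colour_cases with
  | inC i =>
    have : e (e'.symm i) = i := e'.apply_symm_apply i
    simp [α, he, this]
  | outC => simp [α, hθ]

/-- If there are at least two inputs, then the output is the only colour fixed by all
endomorphisms of the corolla. -/
theorem corollaObj_iso_outC {n : ℕ} (hn : n ≠ 1)
    (θ : corollaObj Φ n ≅ F.obj (corollaObj Φ n)) :
    θ.hom.hom.onColour outC = mapColour F (X := corollaObj Φ n) outC := by
  have hbij := onColour_bijective_of_isIso θ.hom
  obtain ⟨x, hx⟩ := hbij.2 (mapColour F (X := corollaObj Φ n) outC)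
  induction x using corolla_colour_cases with
  | outC => exact hx
  | inC i =>
    obtain ⟨j, hj⟩ : ∃ j, j ≠ i := by
      have : Nontrivial (Fin n) := Fin.nontrivial_iff_two_le.mpr (by have := i.pos; omega)
      exact exists_ne i
    let g : corollaObj Φ n ⟶ corollaObj Φ n :=
      ObjectProperty.homMk (opHom ((corolla n).perm (gen n) (Equiv.swap i j)))
    let g' := F.preimage (θ.inv ≫ g ≫ θ.hom)
    have h1 : g'.hom.onColour outC = outC := by
      rcases corolla_hom_cases g'.hom with ⟨h, -⟩ | ⟨h, -⟩
      exacts [(hn h).elim, h]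
    have h2 : (θ.hom ≫ F.map g').hom.onColour (inC i) = θ.hom.hom.onColour (inC i) := by
      change (F.map g').hom.onColour (θ.hom.hom.onColour (inC i)) = _
      rw [hx, mapColour_naturality, h1]
    have h3 : θ.hom ≫ F.map g' = g ≫ θ.hom := by simp [g']
    rw [h3] at h2
    have h4 : g.hom.onColour (inC i) = inC i := hbij.1 h2
    exact (hj (inC_injective n (by simpa [g] using h4))).elim

theorem exists_corollaObj_iso (n : ℕ) :
    ∃ θ : corollaObj Φ n ≅ F.obj (corollaObj Φ n),
      ∀ x, θ.hom.hom.onColour x = mapColour F x := by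
  have hne : ∀ {n : ℕ}, n ≠ 1 → ∃ θ : corollaObj Φ n ≅ F.obj (corollaObj Φ n),
      ∀ x, θ.hom.hom.onColour x = mapColour F x := fun {n} hn =>
    exists_corollaObj_iso_of_outC F _
      (corollaObj_iso_outC F hn (nonempty_corollaObj_iso F n).some)
  by_cases hn : n ≠ 1
  · exact hne hn
  obtain rfl := not_not.mp hn
  obtain ⟨θ⟩ := nonempty_corollaObj_iso F 1
  refine exists_corollaObj_iso_of_outC F θ ?_
  -- Otherwise `F` reverses unary operations, and then nullary operations could be pulled back
  -- along unary operations in every operad.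
  have hbij := onColour_bijective_of_isIso θ.hom
  obtain ⟨x, hx⟩ := hbij.2 (mapColour F (X := corollaObj Φ 1) outC)
  induction x using corolla_colour_cases with
  | outC => exact hx
  | inC i =>
    obtain rfl := Subsingleton.elim i 0
    obtain ⟨y, hy⟩ := hbij.2 (mapColour F (X := corollaObj Φ 1) (inC 0))
    have hout : θ.hom.hom.onColour outC = mapColour F (X := corollaObj Φ 1) (inC 0) := by
      induction y using corolla_colour_cases with
      | outC => exact hy
      | inC i =>
        rw [Subsingleton.elim i 0, hx] at hy
        exact (inC_ne_outC _ (mapColour_injective F _ hy).symm).elim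
    obtain ⟨θ₀, hθ₀⟩ := hne (n := 0) zero_ne_one
    let X : Φ.FullSubcategory :=
      ⟨implication, IsGraftingClosed.of_isRigid _ isRigid_implication⟩
    obtain ⟨z⟩ := nonempty_nullary_true.{u} nofun
    obtain ⟨q⟩ := nonempty_false_true.{u}
    let z' : corollaObj Φ 0 ⟶ F.obj X :=
      θ₀.hom ≫ F.map (ObjectProperty.homMk (opHom z))
    let q' : corollaObj Φ 1 ⟶ F.obj X := θ.hom ≫ F.map (ObjectProperty.homMk (opHom q))
    have hz' : z'.hom.onColour outC = mapColour F (X := X) (truth true) := by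
      simp only [z', ObjectProperty.FullSubcategory.comp_hom, comp_onColour, hθ₀]
      rw [mapColour_naturality]
      simp
    have hqi : q'.hom.onColour (inC 0) = mapColour F (X := X) (truth true) := by
      simp only [q', ObjectProperty.FullSubcategory.comp_hom, comp_onColour, hx]
      rw [mapColour_naturality]
      simp
    have hqo : q'.hom.onColour outC = mapColour F (X := X) (truth false) := by
      simp only [q', ObjectProperty.FullSubcategory.comp_hom, comp_onColour, hout]
      rw [mapColour_naturality]
      simp
    obtain ⟨s, -⟩ := exists_opHom_eq (c := fun i : Fin 0 => i.elim0) z'.hom (fun i => i.elim0) hz'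
    obtain ⟨r, -⟩ := exists_opHom_eq (c := fun _ => mapColour F (X := X) (truth true)) q'.hom
      (fun i => by rw [Subsingleton.elim i 0, hqi]) hqo
    obtain ⟨t⟩ := nonempty_nullary r s
    let t' : F.obj (corollaObj Φ 0) ⟶ F.obj X := θ₀.inv ≫ ObjectProperty.homMk (opHom t)
    have ht : (F.preimage t').hom.onColour outC = truth false := by
      apply mapColour_injective F X
      rw [← mapColour_naturality, F.map_preimage, ← hθ₀]
      change (θ₀.hom ≫ t').hom.onColour outC = _
      simp [t']
    obtain ⟨w, -⟩ := exists_opHom_eq (c := fun i : Fin 0 => i.elim0) (F.preimage t').hom (fun i => i.elim0) ht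
    exact ((isEmpty_nullary_false _).false w).elim

end

end Operad

namespace Operad

variable {Φ : ObjectProperty Operad.{u}} [IsGraftingClosed Φ]

/-! ### Autoequivalences and operations -/

section

/-- The morphism classifying an operation, in a full subcategory. -/
noncomputable abbrev opMor {X : Φ.FullSubcategory} {n : ℕ} {c : Fin n → X.obj.Colour}
    {d : X.obj.Colour} (p : X.obj.Ops c d) : corollaObj Φ n ⟶ X :=
  ObjectProperty.homMk (opHom p)

theorem opMor_hom {X : Φ.FullSubcategory} {n : ℕ} (k : corollaObj Φ n ⟶ X) :
    opMor (k.hom.onOps (gen n)) = k :=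
  ObjectProperty.hom_ext _ (opHom_onOps_gen k.hom)

theorem opMor_comp {X Y : Φ.FullSubcategory} (f : X ⟶ Y) {n : ℕ} {c : Fin n → X.obj.Colour}
    {d : X.obj.Colour} (p : X.obj.Ops c d) :
    opMor p ≫ f = opMor (X := Y) (c := f.hom.onColour ∘ c) (d := f.hom.onColour d)
      (f.hom.onOps p) :=
  ObjectProperty.hom_ext _ (opHom_comp p f.hom)

variable (F : Φ.FullSubcategory ⥤ Φ.FullSubcategory) [F.IsEquivalence]

/-- The isomorphism between a corolla and its image under an autoequivalence that is compatible with
the action on colours. -/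
noncomputable def corollaIso (n : ℕ) : corollaObj Φ n ≅ F.obj (corollaObj Φ n) :=
  (exists_corollaObj_iso F n).choose

theorem corollaIso_onColour {n : ℕ} (x : (corolla.{u} n).Colour) :
    (corollaIso F n).hom.hom.onColour x = mapColour F (X := corollaObj Φ n) x :=
  (exists_corollaObj_iso F n).choose_spec x

theorem corollaIso_naturality {n : ℕ} (f : corollaObj Φ n ⟶ corollaObj Φ n) :
    (corollaIso F n).hom ≫ F.map f = f ≫ (corollaIso F n).hom := by
  refine corollaObj_hom_ext F ?_
  funext x
  change (F.map f).hom.onColour ((corollaIso F n).hom.hom.onColour x) =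
    (corollaIso F n).hom.hom.onColour (f.hom.onColour x)
  rw [corollaIso_onColour, corollaIso_onColour, mapColour_naturality]

theorem corollaIso_trivial (f : corollaObj Φ 1 ⟶ trivObj Φ) :
    (corollaIso F 1).hom ≫ F.map f = f ≫ (trivIso F).hom := by
  rw [← cancel_mono (trivIso F).inv]
  exact trivObj_hom_ext _ _

section

variable {X : Φ.FullSubcategory} {n : ℕ} {c : Fin n → X.obj.Colour} {d : X.obj.Colour}

theorem exists_mapOp (p : X.obj.Ops c d) :
    ∃ r : (F.obj X).obj.Ops (mapColour F ∘ c) (mapColour F d),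
      opMor r = (corollaIso F n).hom ≫ F.map (opMor p) := by
  obtain ⟨r, hr⟩ := exists_opHom_eq (c := mapColour F ∘ c) (d := mapColour F d)
    ((corollaIso F n).hom ≫ F.map (opMor p)).hom (fun i => by
      change (F.map (opMor p)).hom.onColour ((corollaIso F n).hom.hom.onColour _) = _
      rw [corollaIso_onColour, mapColour_naturality]
      simp) (by
      change (F.map (opMor p)).hom.onColour ((corollaIso F n).hom.hom.onColour _) = _
      rw [corollaIso_onColour, mapColour_naturality]
      simp)
  exact ⟨r, ObjectProperty.hom_ext _ hr⟩

/-- The action of an autoequivalence on operations, regarded as morphisms from corollas. -/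
noncomputable def mapOp (p : X.obj.Ops c d) :
    (F.obj X).obj.Ops (mapColour F ∘ c) (mapColour F d) := (exists_mapOp F p).choose

theorem opMor_mapOp (p : X.obj.Ops c d) :
    opMor (mapOp F p) = (corollaIso F n).hom ≫ F.map (opMor p) := (exists_mapOp F p).choose_spec

theorem opMor_injective {p p' : X.obj.Ops c d} (h : opMor p = opMor p') : p = p' :=
  opHom_injective (congrArg InducedCategory.Hom.hom h)

theorem mapOp_bijective :
    Function.Bijective (fun p : X.obj.Ops c d => mapOp F p) := by
  refine ⟨fun p p' h => ?_, fun r => ?_⟩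
  · have h' := congrArg opMor h
    dsimp only at h'
    rw [opMor_mapOp, opMor_mapOp, cancel_epi] at h'
    exact opMor_injective (F.map_injective h')
  · let g := F.preimage ((corollaIso F n).inv ≫ opMor r)
    have hg : ∀ x, mapColour F (g.hom.onColour x) = (opHom r).onColour x := by
      intro x
      rw [← mapColour_naturality, F.map_preimage, ← corollaIso_onColour]
      change ((corollaIso F n).hom ≫ (corollaIso F n).inv ≫ opMor r).hom.onColour x = _
      rw [Iso.hom_inv_id_assoc]
      rfl
    obtain ⟨p, hp⟩ := exists_opHom_eq (c := c) (d := d) g.hom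
      (fun i => mapColour_injective F X ((hg _).trans (opHom_inC r i)))
      (mapColour_injective F X ((hg _).trans (opHom_outC r)))
    refine ⟨p, opMor_injective ?_⟩
    have hp' : opMor p = g := ObjectProperty.hom_ext _ hp
    rw [opMor_mapOp, hp', F.map_preimage, Iso.hom_inv_id_assoc]

theorem opMor_mapOp_naturality {Y : Φ.FullSubcategory} (f : X ⟶ Y) (p : X.obj.Ops c d) :
    opMor (mapOp F p) ≫ F.map f = opMor (mapOp F (X := Y) (c := f.hom.onColour ∘ c)
      (d := f.hom.onColour d) (f.hom.onOps p)) := by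
  rw [opMor_mapOp, opMor_mapOp, Category.assoc, ← F.map_comp, opMor_comp]

theorem mapOp_perm (p : X.obj.Ops c d) (σ : Equiv.Perm (Fin n)) :
    mapOp F (X.obj.perm p σ) = (F.obj X).obj.perm (mapOp F p) σ := by
  apply opMor_injective
  have h : ∀ {Y : Φ.FullSubcategory} {c : Fin n → Y.obj.Colour} {d : Y.obj.Colour}
      (p : Y.obj.Ops c d), opMor (Y.obj.perm p σ) =
        opMor (X := corollaObj Φ n) ((corolla n).perm (gen n) σ) ≫ opMor p :=
    fun p => ObjectProperty.hom_ext _ (opHom_perm p σ)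
  rw [opMor_mapOp, h p, h (mapOp F p), opMor_mapOp, F.map_comp, ← Category.assoc, corollaIso_naturality,
    Category.assoc]

theorem mapOp_ident (c : X.obj.Colour) :
    mapOp F (X.obj.ident c) = (F.obj X).obj.ident (mapColour F c) := by
  apply opMor_injective
  have h : ∀ {Y : Φ.FullSubcategory} (c : Y.obj.Colour), opMor (Y.obj.ident c) =
      opMor (X := trivObj Φ) (triv.ident trivC) ≫ ObjectProperty.homMk (colourHom c) :=
    fun c => ObjectProperty.hom_ext _ (opHom_ident c)
  have h' : (trivIso F).hom ≫ F.map (ObjectProperty.homMk (colourHom c)) =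
      ObjectProperty.homMk (colourHom (mapColour F c)) :=
    ObjectProperty.hom_ext _ (colourHom_ext (by
      rw [ObjectProperty.homMk_hom, colourHom_onColour]
      rfl))
  rw [opMor_mapOp, h c, h (mapColour F c), F.map_comp, ← Category.assoc, corollaIso_trivial, Category.assoc, h']

/-- Composition is preserved: by naturality it suffices to consider the composite of all vertices
of a grafting, and this is the only operation of its type. -/
theorem mapOp_comp (p : X.obj.Ops c d) {m : Fin n → ℕ} {b : ∀ i, Fin (m i) → X.obj.Colour}
    (q : ∀ i, X.obj.Ops (b i) (c i)) :
    mapOp F (X.obj.comp p q) =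
      (F.obj X).obj.comp (mapOp F p) (b := fun i => mapColour F ∘ b i) fun i => mapOp F (q i) := by
  let G : Φ.FullSubcategory := ⟨grafting p q, IsGraftingClosed.grafting X.property p q⟩
  let t : G ⟶ X := ObjectProperty.homMk (graftingHom p q)
  let p₀ : G.obj.Ops _ _ := rootOp p q
  let q₀ : ∀ i, G.obj.Ops _ _ := upperOp p q
  have hs := subsingleton_grafting_ops p q
  have hs' : mapOp F (G.obj.comp p₀ q₀) =
      (F.obj G).obj.comp (mapOp F p₀) (b := fun i => mapColour F ∘ _) fun i => mapOp F (q₀ i) := by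
    obtain ⟨r, hr⟩ := (mapOp_bijective F).2 ((F.obj G).obj.comp (mapOp F p₀)
      (b := fun i => mapColour F ∘ _) fun i => mapOp F (q₀ i))
    rw [← hr]
    exact congrArg (mapOp F) (hs.elim _ _)
  have hp : opHom (mapOp F p) = opHom (mapOp F p₀) ≫ (F.map t).hom :=
    congrArg InducedCategory.Hom.hom (opMor_mapOp_naturality F t p₀).symm
  have hq : ∀ i, opHom (mapOp F (q i)) = opHom (mapOp F (q₀ i)) ≫ (F.map t).hom := fun i =>
    congrArg InducedCategory.Hom.hom (opMor_mapOp_naturality F t (q₀ i)).symm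
  have hpq : opHom (mapOp F (X.obj.comp p q)) =
      opHom (mapOp F (G.obj.comp p₀ q₀)) ≫ (F.map t).hom :=
    congrArg InducedCategory.Hom.hom (opMor_mapOp_naturality F t (G.obj.comp p₀ q₀)).symm
  apply opHom_injective
  rw [hpq, hs', opHom_comp, Hom.onOps_comp]
  refine (opHom_comp_congr ?_ fun i => ?_).symm
  · rw [hp, opHom_comp]
  · rw [hq, opHom_comp]

end

/-- The comparison morphism from an operad to its image under an autoequivalence. -/
noncomputable def comparison (X : Φ.FullSubcategory) : X ⟶ F.obj X :=
  ObjectProperty.homMk ({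
    onColour := mapColour F
    onOps := fun p => mapOp F p
    onOps_perm := fun p σ => mapOp_perm F p σ
    onOps_ident := fun c => mapOp_ident F c
    onOps_comp := fun p _ _ q => mapOp_comp F p q } : Hom X.obj (F.obj X).obj)

theorem comp_comparison {X : Φ.FullSubcategory} {n : ℕ} (k : corollaObj Φ n ⟶ X) :
    k ≫ comparison F X = (corollaIso F n).hom ≫ F.map k := by
  rw [← opMor_hom k, opMor_comp, ← opMor_mapOp]
  rfl

theorem hom_ext_of_corollaObj {X Y : Φ.FullSubcategory} {f g : X ⟶ Y}
    (h : ∀ {n : ℕ} (k : corollaObj Φ n ⟶ X), k ≫ f = k ≫ g) : f = g :=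
  ObjectProperty.hom_ext _ (hom_ext_of_corolla fun k =>
    congrArg InducedCategory.Hom.hom (h (ObjectProperty.homMk k)))

theorem isIso_comparison (X : Φ.FullSubcategory) : IsIso (comparison F X) :=
  isIso_of_isIso_hom _ (isIso_of_bijective _ (mapColour_bijective F X)
    fun _ _ => mapOp_bijective F)

/-- Every autoequivalence is isomorphic to the identity functor. -/
noncomputable def idIsoAutoequiv : 𝟭 Φ.FullSubcategory ≅ F :=
  NatIso.ofComponents (fun X => have := isIso_comparison F X; asIso (comparison F X)) fun {X Y} f =>
    hom_ext_of_corollaObj fun {n} (k : corollaObj Φ n ⟶ X) => by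
      have h := comp_comparison F (k ≫ f)
      rw [F.map_comp, ← Category.assoc, ← comp_comparison F k, Category.assoc,
        Category.assoc] at h
      exact h

end

/-- The identity functor has no nontrivial endomorphisms, since its endomorphisms are trivial on the
trivial operad, therefore on colours, therefore on corollas. -/
theorem id_endo_eq (α : 𝟭 Φ.FullSubcategory ⟶ 𝟭 Φ.FullSubcategory) : α = 𝟙 _ := by
  have hcol : ∀ (X : Φ.FullSubcategory) (c : X.obj.Colour), (α.app X).hom.onColour c = c := by
    intro X c
    have h := α.naturality (X := trivObj Φ) (Y := X) (ObjectProperty.homMk (colourHom c))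
    have h' := congrArg (fun f => f.hom.onColour trivC) h
    simpa using h'
  have hcor : ∀ n, α.app (corollaObj Φ n) = 𝟙 _ := fun n =>
    ObjectProperty.hom_ext _ (Hom.ext_of_isThin (isThin_corolla n) (funext (hcol _)))
  ext X : 2
  refine hom_ext_of_corollaObj fun {n} k => ?_
  have h := α.naturality k
  rw [hcor] at h
  simpa using h

end Operad

/-! ### Categories of autoequivalences -/

theorem isContractibleGroupoid_autoequivCat {C : Type w} [Category.{v} C]
    (h₁ : ∀ F : C ⥤ C, F.IsEquivalence → Nonempty (𝟭 C ≅ F))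
    (h₂ : ∀ α : 𝟭 C ⟶ 𝟭 C, α = 𝟙 _) : IsContractibleGroupoid (AutoequivCat C) := by
  have hhom : ∀ X Y : AutoequivCat C, ∃ f : X ≅ Y, ∀ g : X ⟶ Y, g = f.hom := by
    intro X Y
    obtain ⟨a⟩ := h₁ X.obj X.property
    obtain ⟨b⟩ := h₁ Y.obj Y.property
    refine ⟨ObjectProperty.isoMk _ (a.symm ≪≫ b), fun g => ObjectProperty.hom_ext _ ?_⟩
    have := h₂ (a.hom ≫ g.hom ≫ b.inv)
    rw [← cancel_epi a.hom, ← cancel_mono b.inv]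
    simpa using this
  refine ⟨⟨fun {X Y} g => ?_⟩, ⟨⟨𝟭 C, inferInstance⟩⟩, fun X Y => ?_⟩
  · obtain ⟨f, hf⟩ := hhom X Y
    rw [hf g]
    infer_instance
  · obtain ⟨f, hf⟩ := hhom X Y
    exact ⟨f.hom, trivial, fun g _ => hf g⟩

namespace Operad

theorem isContractibleGroupoid_autoequivCat_fullSubcategory (Φ : ObjectProperty Operad.{u})
    [IsGraftingClosed Φ] : IsContractibleGroupoid (AutoequivCat Φ.FullSubcategory) :=
  isContractibleGroupoid_autoequivCat (fun F _ => ⟨idIsoAutoequiv F⟩) id_endo_eq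

instance : IsGraftingClosed (⊤ : ObjectProperty Operad.{u}) where
  of_isRigid _ _ := trivial
  grafting _ _ _ _ _ _ _ _ := trivial

instance : IsGraftingClosed (fun P : Operad.{u} => P.IsRigid) where
  of_isRigid _ hP := hP
  grafting hP _ _ _ p _ _ q := isRigid_grafting p q hP

theorem isContractibleGroupoid_autoequivCat_operad :
    IsContractibleGroupoid (AutoequivCat Operad.{u}) := by
  let e : (⊤ : ObjectProperty Operad.{u}).FullSubcategory ≌ Operad.{u} :=
    ObjectProperty.topEquivalence _
  refine isContractibleGroupoid_autoequivCat (fun F _ => ?_) fun α => ?_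
  · let i := idIsoAutoequiv (e.functor ⋙ F ⋙ e.inverse)
    exact ⟨e.counitIso.symm ≪≫
      Functor.isoWhiskerLeft e.inverse (Functor.isoWhiskerRight i e.functor) ≪≫
      Functor.isoWhiskerRight e.counitIso (F ⋙ e.inverse ⋙ e.functor) ≪≫
      Functor.isoWhiskerLeft F e.counitIso⟩
  · let β : 𝟭 (⊤ : ObjectProperty Operad.{u}).FullSubcategory ⟶ 𝟭 _ :=
      { app := fun X => ObjectProperty.homMk (α.app X.obj)
        naturality := fun X Y f => ObjectProperty.hom_ext _ (α.naturality f.hom) }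
    ext P : 2
    let X : (⊤ : ObjectProperty Operad.{u}).FullSubcategory := ⟨P, trivial⟩
    have h : (ObjectProperty.homMk (α.app P) : X ⟶ X) = 𝟙 X :=
      congrArg (fun γ => NatTrans.app γ X) (id_endo_eq β)
    exact congrArg (fun f : X ⟶ X => f.hom) h

end Operad

theorem mainTheorem7 :
    IsContractibleGroupoid (AutoequivCat Operad.{u}) ∧
      IsContractibleGroupoid (AutoequivCat RigidOperad.{u}) :=
  ⟨Operad.isContractibleGroupoid_autoequivCat_operad,
    Operad.isContractibleGroupoid_autoequivCat_fullSubcategory _⟩
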